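/- Let $G$ be a connected (finite-dimensional, real) Lie group acting smoothly on a smooth manifold $M$ (finite-dimensional, without boundary), and let $G$ act diagonally on the powers $M^m$. Notation, for $m\ge 0$: * $\mathcal L^{G,m}$ is the distribution on $M^m$ spanned at each point by the values of the infinitesimal generators of the action of $G$ on $M^m$. * $\mathcal A^{G,m}$ is the sheaf of local $m$-joint invariants: $\mathcal A^{G,m}(U)$ consists of the smooth functions on the open set $U\subseteq M^m$ that are locally constant on $G\bar p\cap U$ for each $\bar p\in U$, where the orbit $G\bar p$ carries its own topology as a quotient of $G$ (equivalently, the smooth functions killed by all infinitesimal generators). * A Pfaff system $\Sigma$ is a sheaf of differential ideals generated by $1$-forms; it is determined by its degree-one part, a sheaf of $\mathcal C^\infty$-modules of $1$-forms. Its first integrals on $U$ are the smooth $f$ with $df\in\Sigma(U)$, and $\Sigma^\perp_x$ is the space of tangent vectors at $x$ killed by all sections of $\Sigma$ near $x$. $\Sigma$ is regular of rank $r$ if its germ at every point is generated by $r$ sections that are linearly independent at that point; it is regular on an open set if, near every point of that set, it is regular of some rank. It is integrable if it is generated by the differentials of its first integrals. * $\Sigma^{G,m}$ is the Pfaff system on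 $M^m$ generated by the $1$-forms on open sets vanishing on $\mathcal L^{G,m}$. * For sheaves $\mathcal R_1,\dots,\mathcal R_s$ of smooth functions, $\mathcal R_1\odot\dots\odot\mathcal R_s$ is the sheaf of first integrals of the Pfaff system $\{d\mathcal R_1,\dots,d\mathcal R_s\}$ generated by the differentials of their sections. * $\pi_i^k\colon M^k\to M^{k-1}$ drops the $i$-th component, and $\pi_i^{k*}\mathcal R$ is the sheaf of the functions that are locally of the form $h\circ\pi_i^k$ with $h$ a section of $\mathcal R$. **Proposition.** Let $k\ge 1$. Assume that $\Sigma^{G,k-1}$ is regular and integrable on a dense open subset $W_{k-1}$ of $M^{k-1}$, and that there is a dense open subset $W_k$ of $M^k$ such that for all $\bar p\in W_k$ $$\bigcap_{i=1}^k\bigl(\mathcal L^{G,k}_{\bar p}+\ker(d_{\bar p}\pi_i^k)\bigr)=\mathcal L^{G,k}_{\bar p}.$$ Let $W$ be the set of the $\bar p\in W_k$ such that for every $i$ the point $\pi_i^k(\bar p)$ lies in $W_{k-1}$ and $(\Sigma^{G,k-1})^\perp=\mathcal L^{G,k-1}$ at that point. Then $W$ is a dense open subset of $M^k$, and: 1.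 On $W$ there is the equality of sheaves $$\mathcal A^{G,k}=\pi_1^{k*}\mathcal A^{G,k-1}\odot\dots\odot\pi_k^{k*}\mathcal A^{G,k-1}.$$ 2. For every open $U\subseteq M^k$, a smooth function $f$ on $U$ belongs to $\mathcal A^{G,k}(U)$ if and only if $f|_{U\cap W}$ is a section of $\pi_1^{k*}\mathcal A^{G,k-1}\odot\dots\odot\pi_k^{k*}\mathcal A^{G,k-1}$ over $U\cap W$. 3. Each $f\in\mathcal A^{G,k}(U)$ is, near every point $\bar p\in U\cap W$, of the form $f=F(h_1\circ\pi_{i_1}^k,\dots,h_r\circ\pi_{i_r}^k)$, where each $h_j$ is a local $(k-1)$-joint invariant defined near $\pi_{i_j}^k(\bar p)$ and $F$ is a smooth function on an open subset of $\mathbb R^r$. -/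

import Mathlib

open Set Filter Topology TopologicalSpace
open scoped Manifold ContDiff

noncomputable section

namespace JointInvariants

section General

variable {E H : Type*} [NormedAddCommGroup E] [NormedSpace ℝ E] [TopologicalSpace H]
  (I : ModelWithCorners ℝ E H) {X : Type*} [TopologicalSpace X] [ChartedSpace H X]

variable (X) in
/-- Not necessarily smooth differential `1`-forms on the manifold `X`. A `1`-form *on an open set*
`U` is represented by any such family; only its values at the points of `U` matter. -/
abbrev OneForm := (x : X) → (TangentSpace I x →L[ℝ] Bundle.Trivial X ℝ x)

variable {I} in
/-- Smoothness (on a set `U`) of a `1`-form, as a section of the cotangent bundle. -/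
def OneForm.SmoothOn [IsManifold I ∞ X] (θ : OneForm I X) (U : Set X) : Prop :=
  ContMDiffOn I (I.prod 𝓘(ℝ, E →L[ℝ] ℝ)) ∞
    (fun x ↦ Bundle.TotalSpace.mk' (E →L[ℝ] ℝ)
      (E := fun x : X ↦ TangentSpace I x →L[ℝ] Bundle.Trivial X ℝ x) x (θ x)) U

/-- The differential of a real function. -/
def differential (f : X → ℝ) : OneForm I X := fun x ↦ mfderiv I 𝓘(ℝ, ℝ) f x

variable (X) in
/-- A subsheaf (of sets) of the sheaf of smooth real functions on `X`. A function on an open set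
`U` is represented by any function on `X` that agrees with it on `U`; by `congr` membership in
`sections U` depends only on the values on `U`. -/
structure FunctionSheaf where
  sections : Opens X → Set (X → ℝ)
  smooth : ∀ {U : Opens X} {f}, f ∈ sections U → ContMDiffOn I 𝓘(ℝ, ℝ) ∞ f U
  congr : ∀ {U : Opens X} {f g}, f ∈ sections U → (∀ x ∈ U, g x = f x) → g ∈ sections U
  restrict : ∀ {U V : Opens X} {f}, V ≤ U → f ∈ sections U → f ∈ sections V
  glue : ∀ {U : Opens X} {f}, (∀ x ∈ U, ∃ V ≤ U, x ∈ V ∧ f ∈ sections V) → f ∈ sections U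

variable (X) in
/-- A Pfaff system on `X`. An exterior differential system that is generated, as a sheaf of
differential ideals, by its sections of degree one (and has no nonzero section of degree zero) is
the same as its part of degree one, which is an arbitrary sheaf of `C^∞`-submodules of the sheaf of
smooth `1`-forms; so it is encoded by this sheaf of submodules. -/
structure PfaffSystem [IsManifold I ∞ X] where
  sections : Opens X → Set (OneForm I X)
  smooth : ∀ {U : Opens X} {θ}, θ ∈ sections U → θ.SmoothOn U
  congr : ∀ {U : Opens X} {θ η}, θ ∈ sections U → (∀ x ∈ U, η x = θ x) → η ∈ sections U
  restrict : ∀ {U V : Opens X} {θ}, V ≤ U → θ ∈ sections U → θ ∈ sections V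
  glue : ∀ {U : Opens X} {θ}, (∀ x ∈ U, ∃ V ≤ U, x ∈ V ∧ θ ∈ sections V) → θ ∈ sections U
  zero_mem : ∀ U, 0 ∈ sections U
  add_mem : ∀ {U : Opens X} {θ η}, θ ∈ sections U → η ∈ sections U → θ + η ∈ sections U
  smul_mem : ∀ {U : Opens X} {θ} {c : X → ℝ}, ContMDiffOn I 𝓘(ℝ, ℝ) ∞ c U → θ ∈ sections U →
    (fun x ↦ c x • θ x) ∈ sections U

variable {I}

/-- `η` is, on `V`, a linear combination with smooth coefficients of the forms `θ j`. -/
def IsSmoothCombinationOn {n : ℕ} (η : OneForm I X) (θ : Fin n → OneForm I X) (V : Opens X) :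
    Prop :=
  ∃ c : Fin n → X → ℝ, (∀ j, ContMDiffOn I 𝓘(ℝ, ℝ) ∞ (c j) V) ∧
    ∀ x ∈ V, η x = ∑ j, c j x • θ j x

lemma IsSmoothCombinationOn.mono {n : ℕ} {η : OneForm I X} {θ : Fin n → OneForm I X}
    {V V' : Opens X} (h : IsSmoothCombinationOn η θ V) (hV : V' ≤ V) :
    IsSmoothCombinationOn η θ V' := by
  obtain ⟨c, hc, he⟩ := h
  exact ⟨c, fun j ↦ (hc j).mono hV, fun x hx ↦ he x (hV hx)⟩

section Smooth

variable [IsManifold I ∞ X]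

lemma OneForm.SmoothOn.mono {θ : OneForm I X} {U V : Set X} (h : θ.SmoothOn U) (hV : V ⊆ U) :
    θ.SmoothOn V := ContMDiffOn.mono h hV

lemma OneForm.SmoothOn.congr {θ η : OneForm I X} {U : Set X} (h : θ.SmoothOn U)
    (hη : ∀ x ∈ U, η x = θ x) : η.SmoothOn U :=
  ContMDiffOn.congr h fun x hx ↦ by rw [hη x hx]

lemma OneForm.smoothOn_of_local {θ : OneForm I X} {U : Set X}
    (h : ∀ x ∈ U, ∃ V : Opens X, x ∈ V ∧ θ.SmoothOn V) : θ.SmoothOn U := by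
  intro x hx
  obtain ⟨V, hxV, hV⟩ := h x hx
  exact (ContMDiffOn.contMDiffAt hV (V.isOpen.mem_nhds hxV)).contMDiffWithinAt

lemma OneForm.smoothOn_zero (U : Set X) : (0 : OneForm I X).SmoothOn U :=
  (Bundle.contMDiff_zeroSection ℝ
    (fun x : X ↦ TangentSpace I x →L[ℝ] Bundle.Trivial X ℝ x)).contMDiffOn

lemma OneForm.SmoothOn.add {θ η : OneForm I X} {U : Set X} (h : θ.SmoothOn U)
    (h' : η.SmoothOn U) : (θ + η).SmoothOn U := ContMDiffOn.add_section h h'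

lemma OneForm.SmoothOn.smul {θ : OneForm I X} {U : Set X} {c : X → ℝ}
    (hc : ContMDiffOn I 𝓘(ℝ, ℝ) ∞ c U) (h : θ.SmoothOn U) :
    OneForm.SmoothOn (fun x ↦ c x • θ x) U := ContMDiffOn.smul_section hc h

namespace PfaffSystem

/-- The Pfaff system spanned by a family of local `1`-forms (`S U` consists of forms on `U`, of
which the smooth ones are used): its sections are the smooth forms that are locally linear
combinations, with smooth coefficients, of members of the family. -/
def span (S : Opens X → Set (OneForm I X)) : PfaffSystem I X where
  sections U := {η | η.SmoothOn U ∧ ∀ x ∈ U, ∃ V ≤ U, x ∈ V ∧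
    ∃ (n : ℕ) (θ : Fin n → OneForm I X),
      (∀ j, ∃ V' : Opens X, V ≤ V' ∧ θ j ∈ S V' ∧ (θ j).SmoothOn V') ∧
      IsSmoothCombinationOn η θ V}
  smooth h := h.1
  congr := by
    rintro U η η' ⟨h1, h2⟩ he
    refine ⟨h1.congr he, fun x hx ↦ ?_⟩
    obtain ⟨V, hVU, hxV, n, θ, hθ, c, hc, hs⟩ := h2 x hx
    exact ⟨V, hVU, hxV, n, θ, hθ, c, hc, fun y hy ↦ (he y (hVU hy)).trans (hs y hy)⟩
  restrict := by
    rintro U W η hWU ⟨h1, h2⟩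
    refine ⟨h1.mono hWU, fun x hx ↦ ?_⟩
    obtain ⟨V, hVU, hxV, n, θ, hθ, hs⟩ := h2 x (hWU hx)
    refine ⟨V ⊓ W, inf_le_right, ⟨hxV, hx⟩, n, θ, fun j ↦ ?_, hs.mono inf_le_left⟩
    obtain ⟨V', hV', h⟩ := hθ j
    exact ⟨V', inf_le_left.trans hV', h⟩
  glue := by
    intro U η h
    refine ⟨OneForm.smoothOn_of_local fun x hx ↦ ?_, fun x hx ↦ ?_⟩
    · obtain ⟨V, -, hxV, hV, -⟩ := h x hx
      exact ⟨V, hxV, hV⟩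
    · obtain ⟨W, hWU, hxW, -, hW⟩ := h x hx
      obtain ⟨V, hVW, hxV, h'⟩ := hW x hxW
      exact ⟨V, hVW.trans hWU, hxV, h'⟩
  zero_mem U := ⟨OneForm.smoothOn_zero _, fun x hx ↦ ⟨U, le_rfl, hx, 0, Fin.elim0,
    fun j ↦ j.elim0, fun j ↦ j.elim0, fun j ↦ j.elim0, fun y _ ↦ by simp⟩⟩
  add_mem := by
    rintro U η η' ⟨h1, h2⟩ ⟨h1', h2'⟩
    refine ⟨h1.add h1', fun x hx ↦ ?_⟩
    obtain ⟨V, hVU, hxV, n, θ, hθ, c, hc, hs⟩ := h2 x hx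
    obtain ⟨V', hVU', hxV', n', θ', hθ', c', hc', hs'⟩ := h2' x hx
    refine ⟨V ⊓ V', inf_le_left.trans hVU, ⟨hxV, hxV'⟩, n + n', Fin.append θ θ', fun j ↦ ?_,
      Fin.append c c', fun j ↦ ?_, fun y hy ↦ ?_⟩
    · refine Fin.addCases (fun j ↦ ?_) (fun j ↦ ?_) j
      · obtain ⟨W, hW, h⟩ := hθ j
        exact ⟨W, inf_le_left.trans hW, by simpa using h⟩
      · obtain ⟨W, hW, h⟩ := hθ' j
        exact ⟨W, inf_le_right.trans hW, by simpa using h⟩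
    · refine Fin.addCases (fun j ↦ ?_) (fun j ↦ ?_) j
      · simpa using (hc j).mono fun z hz ↦ hz.1
      · simpa using (hc' j).mono fun z hz ↦ hz.2
    · simp [Fin.sum_univ_add, hs y hy.1, hs' y hy.2]
  smul_mem := by
    rintro U η f hf ⟨h1, h2⟩
    refine ⟨h1.smul hf, fun x hx ↦ ?_⟩
    obtain ⟨V, hVU, hxV, n, θ, hθ, c, hc, hs⟩ := h2 x hx
    refine ⟨V, hVU, hxV, n, θ, hθ, fun j y ↦ f y * c j y, fun j ↦ (hf.mono hVU).mul (hc j),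
      fun y hy ↦ ?_⟩
    simp [hs y hy, Finset.smul_sum, mul_smul]

/-- The Pfaff system generated by the `1`-forms on open sets that vanish on the (possibly singular)
distribution `L` of tangent vectors. -/
def ofDistribution (L : (x : X) → Submodule ℝ (TangentSpace I x)) : PfaffSystem I X where
  sections U := {η | η.SmoothOn U ∧ ∀ x ∈ U, ∀ v ∈ L x, η x v = 0}
  smooth h := h.1
  congr h he := ⟨h.1.congr he, fun x hx v hv ↦ by rw [he x hx]; exact h.2 x hx v hv⟩
  restrict hVU h := ⟨h.1.mono hVU, fun x hx ↦ h.2 x (hVU hx)⟩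
  glue := by
    intro U η h
    refine ⟨OneForm.smoothOn_of_local fun x hx ↦ ?_, fun x hx ↦ ?_⟩
    · obtain ⟨V, -, hxV, hV, -⟩ := h x hx
      exact ⟨V, hxV, hV⟩
    · obtain ⟨V, -, hxV, -, hV⟩ := h x hx
      exact hV x hxV
  zero_mem U := ⟨OneForm.smoothOn_zero _, fun x _ v _ ↦ rfl⟩
  add_mem {U η η'} h h' := ⟨h.1.add h'.1, fun x hx v hv ↦ by
    change η x v + η' x v = (0 : ℝ)
    rw [h.2 x hx v hv, h'.2 x hx v hv]
    exact add_zero _⟩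
  smul_mem {U η c} hc h := ⟨h.1.smul hc, fun x hx v hv ↦ by
    change c x • η x v = 0
    rw [h.2 x hx v hv, smul_zero]⟩

/-- The orthogonal distribution `Σ^⊥`. -/
def perp (S : PfaffSystem I X) (x : X) : Submodule ℝ (TangentSpace I x) where
  carrier := {v | ∀ U : Opens X, x ∈ U → ∀ η ∈ S.sections U, η x v = 0}
  zero_mem' U _ η _ := (η x).map_zero
  add_mem' hv hw U hx η hη := by rw [(η x).map_add, hv U hx η hη, hw U hx η hη, add_zero]
  smul_mem' c v hv U hx η hη := by rw [(η x).map_smul, hv U hx η hη, smul_zero]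

/-- The sheaf of first integrals of a Pfaff system: the smooth functions `f` on `U` such that `df`
is a section of the system over `U`. -/
def firstIntegrals (S : PfaffSystem I X) : FunctionSheaf I X where
  sections U := {f | ContMDiffOn I 𝓘(ℝ, ℝ) ∞ f U ∧ differential I f ∈ S.sections U}
  smooth h := h.1
  congr h he := ⟨h.1.congr he, S.congr h.2 fun x hx ↦
    (Filter.eventuallyEq_of_mem (IsOpen.mem_nhds (Opens.isOpen _) hx) he).mfderiv_eq⟩
  restrict hVU h := ⟨h.1.mono hVU, S.restrict hVU h.2⟩
  glue := by
    intro U f h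
    refine ⟨fun x hx ↦ ?_, S.glue fun x hx ↦ ?_⟩
    · obtain ⟨V, -, hxV, hV, -⟩ := h x hx
      exact (hV.contMDiffAt (V.isOpen.mem_nhds hxV)).contMDiffWithinAt
    · obtain ⟨V, hVU, hxV, -, hV⟩ := h x hx
      exact ⟨V, hVU, hxV, hV⟩

/-- The Pfaff system `{dR i | i}` generated by the differentials of the sections of all the sheaves
`R i`. -/
def ofFunctions {ι : Type*} (R : ι → FunctionSheaf I X) : PfaffSystem I X :=
  span fun U ↦ {η | ∃ i, ∃ f ∈ (R i).sections U, η = differential I f}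

/-- Near `x` the Pfaff system is regular of rank `r`: its stalk at `x` is generated by (the germs
of) `r` sections which are linearly independent at `x`. -/
def IsRegularAt (S : PfaffSystem I X) (r : ℕ) (x : X) : Prop :=
  ∃ (U : Opens X) (θ : Fin r → OneForm I X), x ∈ U ∧ (∀ j, θ j ∈ S.sections U) ∧
    LinearIndependent ℝ (fun j ↦ θ j x) ∧
    ∀ V : Opens X, x ∈ V → ∀ η ∈ S.sections V, ∃ V' ≤ V ⊓ U, x ∈ V' ∧
      IsSmoothCombinationOn η θ V'

/-- The restriction of the Pfaff system to `W` is regular, of locally constant rank. -/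
def IsRegularOn (S : PfaffSystem I X) (W : Opens X) : Prop :=
  ∀ x ∈ W, ∃ (U : Opens X) (r : ℕ), x ∈ U ∧ ∀ y ∈ U, S.IsRegularAt r y

/-- The restriction of the Pfaff system to `W` is integrable: it is generated by the differentials
of its first integrals. -/
def IsIntegrableOn (S : PfaffSystem I X) (W : Opens X) : Prop :=
  ∀ U ≤ W, (ofFunctions fun _ : Unit ↦ S.firstIntegrals).sections U = S.sections U

end PfaffSystem

/-- `R₁ ⊙ ⋯ ⊙ Rₖ`, the sheaf of the smooth functions that locally depend functionally on sections
of the sheaves `R i`, i.e. the sheaf of first integrals of `{dR₁, …, dRₖ}`. -/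
def functionalHull {ι : Type*} (R : ι → FunctionSheaf I X) : FunctionSheaf I X :=
  (PfaffSystem.ofFunctions R).firstIntegrals

end Smooth

/-- The inverse image sheaf `φ^* R`: the smooth functions on open subsets of `X` which are
locally of the form `h ∘ φ` with `h` a section of `R`. -/
def FunctionSheaf.pullback {E' H' Y : Type*} [NormedAddCommGroup E'] [NormedSpace ℝ E']
    [TopologicalSpace H'] {I' : ModelWithCorners ℝ E' H'} [TopologicalSpace Y] [ChartedSpace H' Y]
    (φ : X → Y) (R : FunctionSheaf I' Y) : FunctionSheaf I X where
  sections U := {f | ContMDiffOn I 𝓘(ℝ, ℝ) ∞ f U ∧ ∀ x ∈ U, ∃ V ≤ U, x ∈ V ∧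
    ∃ (V' : Opens Y) (h : Y → ℝ), h ∈ R.sections V' ∧ ∀ y ∈ V, φ y ∈ V' ∧ f y = h (φ y)}
  smooth h := h.1
  congr := by
    rintro U f g ⟨h1, h2⟩ he
    refine ⟨h1.congr he, fun x hx ↦ ?_⟩
    obtain ⟨V, hVU, hxV, V', h, hh, hV⟩ := h2 x hx
    exact ⟨V, hVU, hxV, V', h, hh, fun y hy ↦ ⟨(hV y hy).1, (he y (hVU hy)).trans (hV y hy).2⟩⟩
  restrict := by
    rintro U W f hWU ⟨h1, h2⟩
    refine ⟨h1.mono hWU, fun x hx ↦ ?_⟩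
    obtain ⟨V, hVU, hxV, V', h, hh, hV⟩ := h2 x (hWU hx)
    exact ⟨V ⊓ W, inf_le_right, ⟨hxV, hx⟩, V', h, hh, fun y hy ↦ hV y hy.1⟩
  glue := by
    intro U f h
    refine ⟨fun x hx ↦ ?_, fun x hx ↦ ?_⟩
    · obtain ⟨V, -, hxV, hV, -⟩ := h x hx
      exact (hV.contMDiffAt (V.isOpen.mem_nhds hxV)).contMDiffWithinAt
    · obtain ⟨W, hWU, hxW, -, hW⟩ := h x hx
      obtain ⟨V, hVW, hxV, h'⟩ := hW x hxW
      exact ⟨V, hVW.trans hWU, hxV, h'⟩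

end General

section Action

variable {EG HG : Type*} [NormedAddCommGroup EG] [NormedSpace ℝ EG] [TopologicalSpace HG]
  (IG : ModelWithCorners ℝ EG HG) (G : Type*) [TopologicalSpace G] [ChartedSpace HG G] [Group G]
  {E H : Type*} [NormedAddCommGroup E] [NormedSpace ℝ E] [TopologicalSpace H]
  (I : ModelWithCorners ℝ E H) (X : Type*) [TopologicalSpace X] [ChartedSpace H X] [MulAction G X]

variable {G X} in
/-- The infinitesimal generator `ig(A)` of the action attached to a vector `A` in the Lie algebra
`T₁G`. Its value at `x`, the velocity at `t = 0` of `exp(tA) • x`, is the image of `A` by the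
differential at `1` of the orbit map `g ↦ g • x`. -/
def infinitesimalGenerator (A : GroupLieAlgebra IG G) (x : X) : TangentSpace I x :=
  mfderiv IG I (fun g : G ↦ g • x) 1 A

variable {X} in
/-- The distribution `L^G` spanned by the infinitesimal generators of the action. -/
def orbitDistribution (x : X) : Submodule ℝ (TangentSpace I x) :=
  Submodule.span ℝ (Set.range fun A : GroupLieAlgebra IG G ↦ infinitesimalGenerator IG I A x)

/-- The sheaf `A^G` of local invariants: the smooth functions on `U` whose restriction to `Gp ∩ U`
is locally constant for each orbit `Gp`. (Here `Gp` has its own topology, the quotient topology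
from `G`, so that `f` is locally constant on `Gp ∩ U` if and only if `g ↦ f (g • p)` is locally
constant on the set of the `g` with `g • p ∈ U`.) -/
def localInvariants [LieGroup IG ∞ G] [ContinuousSMul G X] : FunctionSheaf I X where
  sections U := {f | ContMDiffOn I 𝓘(ℝ, ℝ) ∞ f U ∧
    ∀ p ∈ U, IsLocallyConstant fun g : {g : G // g • p ∈ U} ↦ f (g.1 • p)}
  smooth h := h.1
  congr {U f f'} h he := ⟨h.1.congr he, fun p hp ↦ by
    have : (fun g : {g : G // g • p ∈ U} ↦ f' (g.1 • p)) = fun g ↦ f (g.1 • p) :=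
      funext fun g ↦ he (g.1 • p) g.2
    rw [this]
    exact h.2 p hp⟩
  restrict {U V f} hVU h := ⟨h.1.mono hVU, fun p hp ↦
    (h.2 p (hVU hp)).comp_continuous (f := fun g : {g : G // g • p ∈ V} ↦
      (⟨g.1, hVU g.2⟩ : {g : G // g • p ∈ U})) (by fun_prop)⟩
  glue := by
    intro U f h
    have := topologicalGroup_of_lieGroup IG ∞ (G := G)
    refine ⟨fun x hx ↦ ?_, fun p hp ↦ ?_⟩
    · obtain ⟨V, -, hxV, hV, -⟩ := h x hx
      exact (hV.contMDiffAt (V.isOpen.mem_nhds hxV)).contMDiffWithinAt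
    · rw [IsLocallyConstant.iff_eventually_eq]
      rintro ⟨g, hg⟩
      obtain ⟨V, -, hxV, -, hV⟩ := h _ hg
      have h1 := (IsLocallyConstant.iff_eventually_eq _).1 (hV _ hxV) ⟨1, by simpa using hxV⟩
      simp only [one_smul] at h1
      rw [nhds_subtype_eq_comap, eventually_comap] at h1 ⊢
      have h2 : ∀ᶠ a : G in 𝓝 1, a • g • p ∈ V := by
        have : ContinuousAt (fun a : G ↦ a • g • p) 1 := by fun_prop
        exact this (V.isOpen.mem_nhds (by simpa using hxV))
      have hc : Tendsto (fun a : G ↦ a * g⁻¹) (𝓝 g) (𝓝 1) := by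
        have : ContinuousAt (fun a : G ↦ a * g⁻¹) g := by fun_prop
        simpa [ContinuousAt] using this
      filter_upwards [hc.eventually h1, hc.eventually h2]
        with a ha hb b hab
      subst hab
      have := ha ⟨b.1 * g⁻¹, hb⟩ rfl
      simpa [smul_smul] using this

end Action

section Joint

variable (E M : Type*) [NormedAddCommGroup E] [NormedSpace ℝ E] [TopologicalSpace M]
  [ChartedSpace E M] (n : ℕ)

/-- The model of the manifold `M ^ n` of `n`-tuples of points of `M`, for `M` modelled on `E`. -/
abbrev powModel : ModelWithCorners ℝ (Fin n → E) (ModelPi fun _ : Fin n ↦ E) :=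
  ModelWithCorners.pi fun _ : Fin n ↦ 𝓘(ℝ, E)

instance isManifold_pow [IsManifold 𝓘(ℝ, E) ∞ M] : IsManifold (powModel E n) ∞ (Fin n → M) := by
  refine isManifold_of_contDiffOn _ _ _ ?_
  rintro _ _ ⟨e, he, rfl⟩ ⟨e', he', rfl⟩
  rw [Set.mem_univ_pi] at he he'
  have h (i : Fin n) : ContDiffOn ℝ ∞ ((e i).symm ≫ₕ e' i) ((e i).symm ≫ₕ e' i).source := by
    simpa [contDiffPregroupoid] using ((contDiffGroupoid ∞ 𝓘(ℝ, E)).compatible (he i) (he' i)).1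
  refine contDiffOn_pi.2 fun i ↦ ?_
  refine (h i).comp (g := ((e i).symm ≫ₕ e' i)) (f := fun x : Fin n → E ↦ x i)
    (contDiff_apply ℝ E i).contDiffOn ?_
  rintro x ⟨⟨hx1, hx2⟩, -⟩
  exact ⟨hx1 i trivial, hx2 i trivial⟩

/-- The projection `π_i : M ^ (n + 1) → M ^ n` that drops the `i`-th component. -/
def dropComponent {M : Type*} {n : ℕ} (i : Fin (n + 1)) (p : Fin (n + 1) → M) : Fin n → M :=
  fun j ↦ p (i.succAbove j)

variable {EG : Type*} [NormedAddCommGroup EG] [NormedSpace ℝ EG] (G : Type*) [TopologicalSpace G]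
  [ChartedSpace EG G] [Group G] [MulAction G M]

variable (EG) {M n} in
/-- The distribution `L^{G,n}` on `M ^ n` spanned by the infinitesimal generators of the diagonal
action of `G`. -/
def jointDistribution (p : Fin n → M) : Submodule ℝ (TangentSpace (powModel E n) p) :=
  orbitDistribution 𝓘(ℝ, EG) G (powModel E n) p

variable (EG) in
/-- The Pfaff system `Σ^{G,n}` on `M ^ n`, generated by the `1`-forms that vanish on `L^{G,n}`. -/
def jointPfaff [IsManifold 𝓘(ℝ, E) ∞ M] : PfaffSystem (powModel E n) (Fin n → M) :=
  PfaffSystem.ofDistribution (jointDistribution E EG G)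

variable (EG) in
/-- The sheaf `A^{G,n}` of local `n`-joint invariants: the local invariants of the diagonal action
of `G` on `M ^ n`. -/
def jointInvariants [LieGroup 𝓘(ℝ, EG) ∞ G] [ContMDiffSMul 𝓘(ℝ, EG) 𝓘(ℝ, E) ∞ G M] :
    FunctionSheaf (powModel E n) (Fin n → M) :=
  have : ContinuousSMul G M := ContMDiffSMul.continuousSMul (I := 𝓘(ℝ, EG)) (I' := 𝓘(ℝ, E)) ∞
  localInvariants 𝓘(ℝ, EG) G (powModel E n) (Fin n → M)

variable (EG) in
/-- The sheaf `π_1^* A^{G,n} ⊙ ⋯ ⊙ π_{n+1}^* A^{G,n}` on `M ^ (n + 1)` of the functions that locally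
depend functionally on liftings of local `n`-joint invariants. -/
def liftedInvariants [IsManifold 𝓘(ℝ, E) ∞ M] [LieGroup 𝓘(ℝ, EG) ∞ G]
    [ContMDiffSMul 𝓘(ℝ, EG) 𝓘(ℝ, E) ∞ G M] :
    FunctionSheaf (powModel E (n + 1)) (Fin (n + 1) → M) :=
  functionalHull fun i : Fin (n + 1) ↦ (jointInvariants E M n EG G).pullback (dropComponent i)

end Joint

end JointInvariants

end

noncomputable section

/-! Write `L` for the orbit distribution. One inclusion is formal: the differential of a section of
the functional hull is pointwise a combination of differentials of lifted invariants, and these kill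
the generators.

For the other, fix `p` in `W` and let `v` be killed by the differentials at `p` of all lifted
invariants. For each `i` the image of `v` under the differential of the `i`-th projection is then
killed by `dh` for every joint invariant `h` near the projected point. The joint invariants are the
first integrals of the Pfaff system, which is integrable there, so this image lies in its orthogonal
distribution, which is `L` at points of `W`. Equivariance lifts it to `L` at `p`, so `v` lies in `L`
plus the kernel of the projection, for every `i`; the intersection hypothesis puts `v` in `L`. Hence
finitely many lifted invariants form a map `Φ`, submersive at `p`, with kernel `L` at `p`. Near `p`
the kernel of `dΦ` has constant dimension and contains `L`, whose dimension cannot drop, so the two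
agree on a neighbourhood (`exists_lifted_submersion`). An invariant `f` has `df = 0` on this kernel,
so `f = F ∘ Φ` (`exists_eq_comp_of_ker_tderiv_le`), and the chain rule makes `df` a section of the
generated Pfaff system.

That `W` is open and dense rests on `isOpen_perp_eq` and `dense_perp_eq`: forms detect `L` wherever
its dimension is locally maximal. Invariance extends from `W` to `U` by continuity of the
derivatives along generators. -/

namespace JointInvariants


/-! ### Functional dependence in a vector space. -/

section FunctionalDependence

/-- If the differential of `f` vanishes on the kernel of the differential of a submersion `Φ`, then
`f` is locally a smooth function of `Φ`. -/
theorem exists_eq_comp_of_ker_fderiv_le {E F : Type*} [NormedAddCommGroup E] [NormedSpace ℝ E]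
    [FiniteDimensional ℝ E] [NormedAddCommGroup F] [NormedSpace ℝ F] [FiniteDimensional ℝ F]
    {Φ : E → F} {f : E → ℝ} {x₀ : E} {s : Set E} (hs : IsOpen s) (hx₀ : x₀ ∈ s)
    (hΦ : ContDiffOn ℝ ∞ Φ s) (hf : ContDiffOn ℝ ∞ f s)
    (hsurj : Function.Surjective (fderiv ℝ Φ x₀))
    (hker : ∀ x ∈ s, ∀ v, fderiv ℝ Φ x v = 0 → fderiv ℝ f x v = 0) :
    ∃ (O : Set F) (k : F → ℝ), IsOpen O ∧ Φ x₀ ∈ O ∧ ContDiffOn ℝ ∞ k O ∧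
      ∀ᶠ x in 𝓝 x₀, Φ x ∈ O ∧ f x = k (Φ x) := by
  have hΦ' : ∀ x ∈ s, ContDiffAt ℝ ∞ Φ x := fun x hx ↦ hΦ.contDiffAt (hs.mem_nhds hx)
  have hf' : ∀ x ∈ s, ContDiffAt ℝ ∞ f x := fun x hx ↦ hf.contDiffAt (hs.mem_nhds hx)
  -- A projection `P` onto the kernel of `dΦ` at `x₀` completes `Φ` to a local diffeomorphism `g =
  -- (Φ, P)`. In these coordinates `f` depends only on the first factor, and `k` is `f` on the slice
  -- where the second factor is `P x₀`.
  obtain ⟨P, hP⟩ := Submodule.ClosedComplemented.of_finiteDimensional_quotient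
    (p := LinearMap.ker (fderiv ℝ Φ x₀).toLinearMap) (Submodule.closed_of_finiteDimensional _)
  set g : E → F × LinearMap.ker (fderiv ℝ Φ x₀).toLinearMap := fun x ↦ (Φ x, P x) with hg
  have hgd : ∀ x ∈ s, HasFDerivAt g ((fderiv ℝ Φ x).prod P) x := fun x hx ↦
    ((hΦ' x hx).differentiableAt (by simp)).hasFDerivAt.prodMk P.hasFDerivAt
  have hgc : ∀ x ∈ s, ContDiffAt ℝ ∞ g x := fun x hx ↦ (hΦ' x hx).prodMk P.contDiff.contDiffAt
  have hPs : P.range = ⊤ := LinearMap.range_eq_top.2 fun y ↦ ⟨y, hP y⟩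
  have hcompl : IsCompl (fderiv ℝ Φ x₀).ker P.ker := LinearMap.isCompl_of_proj hP
  set e := (fderiv ℝ Φ x₀).equivProdOfSurjectiveOfIsCompl P (LinearMap.range_eq_top.2 hsurj) hPs
    hcompl with he
  have hge : HasFDerivAt g (e : E →L[ℝ] F × LinearMap.ker (fderiv ℝ Φ x₀).toLinearMap) x₀ :=
    hgd x₀ hx₀
  set φ := (hgc x₀ hx₀).toOpenPartialHomeomorph g hge (by simp) with hφ
  have hφg : ∀ x, φ x = g x := fun x ↦ rfl
  have hφs : x₀ ∈ φ.source := (hgc x₀ hx₀).mem_toOpenPartialHomeomorph_source hge (by simp)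
  have hleft : φ.symm (g x₀) = x₀ := φ.left_inv hφs
  have hcts : ContinuousAt φ.symm (g x₀) := φ.continuousAt_symm (φ.map_source hφs)
  -- Smoothness of the inverse at a point needs an invertible derivative at that point.
  -- Invertibility is an open condition, so it persists on a ball, which is a product of balls for
  -- the sup norm.
  have hT : ∀ᶠ y in 𝓝 (g x₀), y ∈ φ.target ∧ φ.symm y ∈ s ∧
      ∃ e' : E ≃L[ℝ] F × LinearMap.ker (fderiv ℝ Φ x₀).toLinearMap,
        (e' : E →L[ℝ] _) = (fderiv ℝ Φ (φ.symm y)).prod P := by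
    refine (φ.open_target.eventually_mem (φ.map_source hφs)).and
      (Filter.Eventually.and (hcts (by rw [hleft]; exact hs.mem_nhds hx₀)) ?_)
    have h1 : ContinuousAt (fun x ↦ (fderiv ℝ Φ x).prod P) x₀ := by
      have : ContinuousAt (fderiv ℝ Φ) x₀ := ((hΦ' x₀ hx₀).fderiv_right
        (m := 0) (by simp)).continuousAt
      exact ContinuousAt.comp (f := fun x ↦ (fderiv ℝ Φ x, P))
        (g := ContinuousLinearMap.prodₗᵢ (𝕜 := ℝ) ℝ)
        (LinearIsometryEquiv.continuous _).continuousAt (this.prodMk continuousAt_const)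
    have h2 : ContinuousAt (fun y ↦ (fderiv ℝ Φ (φ.symm y)).prod P) (g x₀) :=
      ContinuousAt.comp (g := fun x ↦ (fderiv ℝ Φ x).prod P) (f := φ.symm)
        (by rwa [hleft]) hcts
    have h3 : range ((↑) : (E ≃L[ℝ] F × LinearMap.ker (fderiv ℝ Φ x₀).toLinearMap) → _) ∈
      𝓝 ((fderiv ℝ Φ (φ.symm (g x₀))).prod P) := by
      rw [hleft]; exact ContinuousLinearEquiv.nhds e
    exact h2 h3
  obtain ⟨ε, hε, hball⟩ := Metric.eventually_nhds_iff_ball.1 hT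
  have hprod : ∀ a ∈ Metric.ball (Φ x₀) ε, ∀ b ∈ Metric.ball (P x₀) ε, (a, b) ∈
      Metric.ball (g x₀) ε := fun a ha b hb ↦ by
    rw [← ball_prod_same]; exact ⟨ha, hb⟩
  have hsymm : ∀ y ∈ Metric.ball (g x₀) ε, ContDiffAt ℝ ∞ φ.symm y := by
    intro y hy
    obtain ⟨h1, h2, e', he'⟩ := hball y hy
    exact φ.contDiffAt_symm h1 (f₀' := e') (by rw [he']; exact hgd _ h2) (hgc _ h2)
  have hk : ∀ y ∈ Metric.ball (g x₀) ε, ContDiffAt ℝ ∞ (f ∘ φ.symm) y := fun y hy ↦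
    (hf' _ (hball y hy).2.1).comp y (hsymm y hy)
  have hconst : ∀ a ∈ Metric.ball (Φ x₀) ε, ∀ b ∈ Metric.ball (P x₀) ε,
      f (φ.symm (a, b)) = f (φ.symm (a, P x₀)) := by
    intro a ha b hb
    have hmk : ∀ b, HasFDerivAt (fun b : LinearMap.ker (fderiv ℝ Φ x₀).toLinearMap ↦ (a, b))
      (ContinuousLinearMap.inr ℝ F _) b := fun b ↦ hasFDerivAt_prodMk_right a b
    have hd : ∀ b ∈ Metric.ball (P x₀) ε,
        HasFDerivAt (fun b ↦ f (φ.symm (a, b)))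
          (((fderiv ℝ f (φ.symm (a, b))).comp (fderiv ℝ φ.symm (a, b))).comp
            (ContinuousLinearMap.inr ℝ F _)) b := by
      intro b hb
      have hy := hprod a ha b hb
      exact ((((hf' _ (hball _ hy).2.1).differentiableAt (by simp)).hasFDerivAt.comp _
        ((hsymm _ hy).differentiableAt (by simp)).hasFDerivAt).comp b (hmk b))
    refine Metric.isOpen_ball.is_const_of_fderiv_eq_zero (𝕜 := ℝ)
      (convex_ball _ _).isPreconnected (f := fun b ↦ f (φ.symm (a, b)))
      (fun b hb ↦ (hd b hb).differentiableAt.differentiableWithinAt) (fun b hb ↦ ?_) hb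
      (Metric.mem_ball_self hε)
    rw [(hd b hb).fderiv]
    have hy := hprod a ha b hb
    obtain ⟨h1, h2, -⟩ := hball _ hy
    -- Differentiating `g ∘ φ.symm = id` shows that the derivative of `φ.symm` sends each `(0, v)`
    -- into the kernel of `dΦ`, where `df` vanishes.
    have hid : (((fderiv ℝ Φ (φ.symm (a, b))).prod P).comp (fderiv ℝ φ.symm (a, b))) =
        ContinuousLinearMap.id ℝ _ := by
      refine ((hgd _ h2).comp _
        ((hsymm _ hy).differentiableAt (by simp)).hasFDerivAt).unique ?_
      refine (hasFDerivAt_id _).congr_of_eventuallyEq ?_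
      filter_upwards [φ.open_target.mem_nhds h1] with z hz
      exact φ.right_inv hz
    ext v
    refine hker _ h2 _ ?_
    have := congrArg Prod.fst (DFunLike.congr_fun hid (0, v))
    simpa using this
  refine ⟨Metric.ball (Φ x₀) ε, fun a ↦ f (φ.symm (a, P x₀)), Metric.isOpen_ball,
    Metric.mem_ball_self hε, fun a ha ↦ ?_, ?_⟩
  · have := (hk _ (hprod a ha _ (Metric.mem_ball_self hε))).comp a
      (f := fun a ↦ (a, P x₀)) (contDiffAt_id.prodMk contDiffAt_const)
    exact this.contDiffWithinAt
  · filter_upwards [φ.open_source.mem_nhds hφs, (hgd x₀ hx₀).continuousAt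
      (Metric.ball_mem_nhds _ hε)] with x hx1 hx2
    have hx3 : g x ∈ Metric.ball (g x₀) ε := hx2
    rw [← ball_prod_same] at hx3
    refine ⟨hx3.1, ?_⟩
    rw [← hconst _ hx3.1 _ hx3.2]
    exact congrArg f (φ.left_inv hx1).symm

end FunctionalDependence

/-! ### Smooth structure and projections of the powers of `M`. -/

section Power

variable {E M : Type*} [NormedAddCommGroup E] [NormedSpace ℝ E] [TopologicalSpace M]
  [ChartedSpace E M] {n : ℕ}

instance boundaryless_powModel : (powModel E n).Boundaryless where
  range_eq_univ := Set.eq_univ_of_forall fun x ↦ ⟨x, rfl⟩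

variable {EN HN N : Type*} [NormedAddCommGroup EN] [NormedSpace ℝ EN] [TopologicalSpace HN]
  {J : ModelWithCorners ℝ EN HN} [TopologicalSpace N] [ChartedSpace HN N] {k : ℕ∞ω}

theorem contMDiffAt_pow_iff {f : N → Fin n → M} {x : N} :
    ContMDiffAt J (powModel E n) k f x ↔ ∀ i, ContMDiffAt J 𝓘(ℝ, E) k (fun y ↦ f y i) x := by
  rw [contMDiffAt_iff_target, contMDiffAt_pi_space, continuousAt_pi, ← forall_and]
  exact forall_congr' fun i ↦ (contMDiffAt_iff_target (I := J) (I' := 𝓘(ℝ, E)) (n := k)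
    (f := fun y ↦ f y i) (x := x)).symm

theorem contMDiff_pow_iff {f : N → Fin n → M} :
    ContMDiff J (powModel E n) k f ↔ ∀ i, ContMDiff J 𝓘(ℝ, E) k (fun y ↦ f y i) :=
  ⟨fun h i x ↦ contMDiffAt_pow_iff.1 (h x) i, fun h x ↦ contMDiffAt_pow_iff.2 fun i ↦ h i x⟩

theorem contMDiff_pow_apply (i : Fin n) :
    ContMDiff (powModel E n) 𝓘(ℝ, E) k (fun p : Fin n → M ↦ p i) :=
  contMDiff_pow_iff.1 contMDiff_id i

theorem contMDiff_dropComponent (i : Fin (n + 1)) :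
    ContMDiff (powModel E (n + 1)) (powModel E n) k
      (dropComponent i : (Fin (n + 1) → M) → Fin n → M) :=
  contMDiff_pow_iff.2 fun j ↦ contMDiff_pow_apply (i.succAbove j)

theorem continuous_dropComponent {M : Type*} [TopologicalSpace M] (i : Fin (n + 1)) :
    Continuous (dropComponent i : (Fin (n + 1) → M) → Fin n → M) :=
  continuous_pi fun j ↦ continuous_apply (i.succAbove j)

/-- Reinserting the component `p i` is a continuous section of the projection that passes through
`p`. Openness makes preimages of dense sets dense. -/
theorem isOpenMap_dropComponent {M : Type*} [TopologicalSpace M] (i : Fin (n + 1)) :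
    IsOpenMap (dropComponent i : (Fin (n + 1) → M) → Fin n → M) := by
  rw [isOpenMap_iff_nhds_le]
  intro p s hs
  have hc : Continuous fun q : Fin n → M ↦ i.insertNth (α := fun _ ↦ M) (p i) q :=
    continuous_const.finInsertNth i continuous_id
  have hp : i.insertNth (α := fun _ ↦ M) (p i) (dropComponent i p) = p :=
    Fin.insertNth_self_removeNth i p
  have := hc.continuousAt (x := dropComponent i p) (by rw [hp]; exact hs)
  filter_upwards [this] with q hq
  have hq' : dropComponent i (i.insertNth (α := fun _ ↦ M) (p i) q) = q :=
    funext fun j ↦ Fin.insertNth_apply_succAbove _ _ _ _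
  rw [← hq']
  exact hq

instance contMDiffSMul_pow {EG HG G : Type*} [NormedAddCommGroup EG] [NormedSpace ℝ EG]
    [TopologicalSpace HG] {IG : ModelWithCorners ℝ EG HG} [TopologicalSpace G] [ChartedSpace HG G]
    [SMul G M] [ContMDiffSMul IG 𝓘(ℝ, E) k G M] :
    ContMDiffSMul IG (powModel E n) k G (Fin n → M) where
  contMDiff_smul := contMDiff_pow_iff.2 fun i ↦
    (contMDiff_smul (I := IG) (I' := 𝓘(ℝ, E))).comp
      (contMDiff_fst.prodMk ((contMDiff_pow_apply i).comp contMDiff_snd))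

end Power


/-! ### Smooth forms and differentials. -/

section Forms

variable {E H : Type*} [NormedAddCommGroup E] [NormedSpace ℝ E] [TopologicalSpace H]
  {I : ModelWithCorners ℝ E H} {X : Type*} [TopologicalSpace X] [ChartedSpace H X]

variable (I) in
/-- The differential at `x` of a map to a vector space, as a linear map on the model space. -/
def tderiv {F : Type*} [NormedAddCommGroup F] [NormedSpace ℝ F] (f : X → F) (x : X) : E →L[ℝ] F :=
  mfderiv I 𝓘(ℝ, F) f x

theorem tderiv_congr {F : Type*} [NormedAddCommGroup F] [NormedSpace ℝ F] {f g : X → F} {x : X}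
    (h : f =ᶠ[𝓝 x] g) : tderiv I f x = tderiv I g x := h.mfderiv_eq

theorem tderiv_comp {F F' : Type*} [NormedAddCommGroup F] [NormedSpace ℝ F]
    [NormedAddCommGroup F'] [NormedSpace ℝ F'] {f : X → F} {g : F → F'} {x : X}
    (hg : DifferentiableAt ℝ g (f x)) (hf : MDifferentiableAt I 𝓘(ℝ, F) f x) :
    tderiv I (g ∘ f) x = (fderiv ℝ g (f x)).comp (tderiv I f x) :=
  (mfderiv_comp x hg.mdifferentiableAt hf).trans (by rw [mfderiv_eq_fderiv]; rfl)

theorem contMDiffOn_opens_iff {EN HN N : Type*} [NormedAddCommGroup EN] [NormedSpace ℝ EN]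
    [TopologicalSpace HN] {J : ModelWithCorners ℝ EN HN} [TopologicalSpace N] [ChartedSpace HN N]
    {k : ℕ∞ω} {U : Opens X} {f : X → N} :
    ContMDiffOn I J k f U ↔ ∀ x ∈ U, ContMDiffAt I J k f x :=
  ⟨fun h _ hx ↦ h.contMDiffAt (U.isOpen.mem_nhds hx), fun h _ hx ↦ (h _ hx).contMDiffWithinAt⟩

variable [IsManifold I ∞ X]

theorem smoothOn_differential {f : X → ℝ} {U : Opens X} (hf : ContMDiffOn I 𝓘(ℝ, ℝ) ∞ f U) :
    (differential I f).SmoothOn U := by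
  intro x hx
  refine ContMDiffAt.contMDiffWithinAt ?_
  rw [contMDiffAt_hom_bundle]
  refine ⟨contMDiffAt_id, ?_⟩
  have : IsManifold I 1 X := IsManifold.of_le (n := ∞) (by simp)
  have h := (contMDiffOn_opens_iff.1 hf x hx).mfderiv_const (m := ∞) (by simp)
  refine h.congr_of_eventuallyEq (Filter.Eventually.of_forall fun y ↦ ?_)
  -- The trivial line bundle and the tangent bundle of `ℝ` are different target bundles, but the
  -- trivializations of both act as the identity, so the two coordinate expressions of the
  -- differential agree.
  have e₁ : (trivializationAt ℝ (Bundle.Trivial X ℝ) x).continuousLinearMapAt ℝ y =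
    ContinuousLinearMap.id ℝ ℝ := Bundle.Trivial.continuousLinearMapAt_trivialization ..
  have e₂ := TangentBundle.continuousLinearMapAt_model_space (𝕜 := ℝ) (f x) (f y)
  exact congrArg (fun S : ℝ →L[ℝ] ℝ ↦ S.comp ((tderiv I f y).comp
    ((trivializationAt E (TangentSpace I) x).symmL ℝ y))) (e₁.trans e₂.symm)

theorem smoothOn_sum {ι : Type*} (s : Finset ι) {θ : ι → OneForm I X} {U : Set X}
    (h : ∀ j ∈ s, (θ j).SmoothOn U) : (∑ j ∈ s, θ j).SmoothOn U := by
  classical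
  induction s using Finset.induction_on with
  | empty => exact OneForm.smoothOn_zero U
  | insert a s ha ih =>
    rw [Finset.sum_insert ha]
    exact (h a (by simp)).add (ih fun j hj ↦ h j (by simp [hj]))

/-- The `1`-form with the coefficients `a` in the chart at `p`. -/
def formOfChart (p : X) (a : X → E →L[ℝ] ℝ) : OneForm I X :=
  fun x ↦ (a x).comp (tderiv I (extChartAt I p) x)

theorem mdifferentiableAt_chart {p x : X} (hx : x ∈ (extChartAt I p).source) :
    MDifferentiableAt I 𝓘(ℝ, E) (extChartAt I p) x :=
  (contMDiffAt_extChartAt' (n := ∞) (by simpa using hx)).mdifferentiableAt (by simp)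

theorem bijective_tderiv_chart {p x : X} (hx : x ∈ (extChartAt I p).source) :
    Function.Bijective (tderiv I (extChartAt I p) x) := by
  have : IsManifold I 1 X := IsManifold.of_le (n := ∞) (by simp)
  obtain ⟨e, he⟩ := isInvertible_mfderiv_extChartAt (I := I) hx
  have h : Function.Bijective (mfderiv I 𝓘(ℝ, E) (extChartAt I p) x) := he ▸ e.bijective
  exact h

/-- In a basis `b` of the model space the form is the sum of `a (b j)` times the differential of the
`j`-th coordinate function, a combination of smooth forms with smooth coefficients. -/
theorem smoothOn_formOfChart [FiniteDimensional ℝ E] {p : X} {a : X → E →L[ℝ] ℝ} {U : Opens X}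
    (hU : (U : Set X) ⊆ (extChartAt I p).source)
    (ha : ContMDiffOn I 𝓘(ℝ, E →L[ℝ] ℝ) ∞ a U) : (formOfChart (I := I) p a).SmoothOn U := by
  set b := Module.finBasis ℝ E
  have hsum : (∑ j, fun x ↦ (a x (b j)) • differential I
      ((b.coord j).toContinuousLinearMap ∘ extChartAt I p) x : OneForm I X).SmoothOn U := by
    refine smoothOn_sum _ fun j _ ↦ OneForm.SmoothOn.smul ?_ (smoothOn_differential ?_)
    · exact ha.clm_apply contMDiffOn_const
    · exact (ContinuousLinearMap.contMDiff _).comp_contMDiffOn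
        ((contMDiffOn_extChartAt (n := ∞)).mono (by simpa using hU))
  refine hsum.congr fun x hx ↦ ?_
  ext v
  have hd : ∀ j, tderiv I ((b.coord j).toContinuousLinearMap ∘ extChartAt I p) x v =
      b.coord j (tderiv I (extChartAt I p) x v) := fun j ↦ by
    rw [tderiv_comp (ContinuousLinearMap.differentiableAt _) (mdifferentiableAt_chart (hU hx)),
      ContinuousLinearMap.fderiv]
    rfl
  have h : a x (tderiv I (extChartAt I p) x v) = ∑ j, a x (b j) *
      tderiv I ((b.coord j).toContinuousLinearMap ∘ extChartAt I p) x v := by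
    simp only [hd]
    generalize tderiv I (extChartAt I p) x v = w
    conv_lhs => rw [← b.sum_repr w, map_sum]
    exact Finset.sum_congr rfl fun j _ ↦ by rw [map_smul, smul_eq_mul, mul_comm]; rfl
  refine h.trans ?_
  rw [Finset.sum_apply, sum_apply]
  rfl

end Forms

/-! ### Functional dependence on a manifold. -/

section Submersion

variable {E H : Type*} [NormedAddCommGroup E] [NormedSpace ℝ E]
  [TopologicalSpace H]
  {I : ModelWithCorners ℝ E H} [I.Boundaryless] {X : Type*} [TopologicalSpace X]
  [ChartedSpace H X] [IsManifold I ∞ X]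
  {F : Type*} [NormedAddCommGroup F] [NormedSpace ℝ F]

/-- As the differential of the chart is bijective, this transfers surjectivity and kernel conditions
between the manifold and its model space. -/
theorem tderiv_eq_fderiv_comp {p x : X} (hx : x ∈ (extChartAt I p).source) {Φ : X → F}
    (hΦ : ContMDiffAt I 𝓘(ℝ, F) ∞ Φ x) :
    ContDiffAt ℝ ∞ (Φ ∘ (extChartAt I p).symm) (extChartAt I p x) ∧ ∀ v,
      tderiv I Φ x v = fderiv ℝ (Φ ∘ (extChartAt I p).symm) (extChartAt I p x)
        (tderiv I (extChartAt I p) x v) := by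
  have hinv : (extChartAt I p).symm (extChartAt I p x) = x := (extChartAt I p).left_inv hx
  have hs : ContMDiffAt 𝓘(ℝ, E) I ∞ (extChartAt I p).symm (extChartAt I p x) :=
    (contMDiffOn_extChartAt_symm p).contMDiffAt
      (extChartAt_target_mem_nhds' ((extChartAt I p).map_source hx))
  have hc : ContMDiffAt 𝓘(ℝ, E) 𝓘(ℝ, F) ∞ (Φ ∘ (extChartAt I p).symm) (extChartAt I p x) :=
    ContMDiffAt.comp _ (by rwa [hinv]) hs
  refine ⟨hc.contDiffAt, fun v ↦ ?_⟩
  have h := tderiv_comp (hc.contDiffAt.differentiableAt (by simp)) (mdifferentiableAt_chart hx)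
  rw [← ContinuousLinearMap.comp_apply, ← h]
  refine congrArg (fun T : E →L[ℝ] F ↦ T v) (tderiv_congr ?_)
  filter_upwards [extChartAt_source_mem_nhds' hx] with y hy
  exact congrArg Φ ((extChartAt I p).left_inv hy).symm

variable [FiniteDimensional ℝ E] [FiniteDimensional ℝ F]

/-- Surjectivity means rank at least `dim F`, an open condition on linear maps, and the derivative
is continuous. -/
theorem eventually_surjective_fderiv {Φ : E → F} {x : E} (hΦ : ContDiffAt ℝ ∞ Φ x)
    (hs : Function.Surjective (fderiv ℝ Φ x)) :
    ∀ᶠ y in 𝓝 x, Function.Surjective (fderiv ℝ Φ y) := by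
  have hiff : ∀ T : E →L[ℝ] F, Function.Surjective T ↔
      ((Module.finrank ℝ F : ℕ) : Cardinal) ≤ (T : E →ₗ[ℝ] F).rank := fun T ↦ by
    rw [LinearMap.rank, ← Module.finrank_eq_rank, Nat.cast_le]
    constructor
    · intro h
      rw [LinearMap.range_eq_top.2 h, finrank_top]
    · intro h
      exact LinearMap.range_eq_top.1 (Submodule.eq_top_of_finrank_eq
        (le_antisymm (Submodule.finrank_le _) h))
  have hc : ContinuousAt (fderiv ℝ Φ) x := (hΦ.fderiv_right (m := 0) (by simp)).continuousAt
  filter_upwards [hc ((isOpen_setOfPred_nat_le_rank (𝕜 := ℝ) (E := E) (F := F)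
    (Module.finrank ℝ F)).mem_nhds ((hiff _).1 hs))] with y hy
  exact (hiff _).2 hy

theorem eventually_surjective_tderiv {Φ : X → F} {p : X} {U : Opens X} (hp : p ∈ U)
    (hΦ : ContMDiffOn I 𝓘(ℝ, F) ∞ Φ U) (hs : Function.Surjective (tderiv I Φ p)) :
    ∀ᶠ q in 𝓝 p, Function.Surjective (tderiv I Φ q) := by
  rw [contMDiffOn_opens_iff] at hΦ
  have hps := mem_extChartAt_source (I := I) p
  obtain ⟨h1, h2⟩ := tderiv_eq_fderiv_comp hps (hΦ p hp)
  have h3 := eventually_surjective_fderiv h1 fun w ↦ by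
    obtain ⟨v, hv⟩ := hs w
    exact ⟨_, (h2 v).symm.trans hv⟩
  filter_upwards [(continuousAt_extChartAt (I := I) p).eventually h3, U.isOpen.mem_nhds hp,
    extChartAt_source_mem_nhds (I := I) p] with q hq hqU hqs w
  obtain ⟨u, hu⟩ := hq w
  obtain ⟨v, hv⟩ := (bijective_tderiv_chart hqs).2 u
  exact ⟨v, by rw [(tderiv_eq_fderiv_comp hqs (hΦ q hqU)).2 v, hv, hu]⟩

/-- If the differential of `f` vanishes on the kernel of the differential of a submersion `Φ`, then
`f` is locally a smooth function of `Φ`. -/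
theorem exists_eq_comp_of_ker_tderiv_le {Φ : X → F} {f : X → ℝ} {p : X} {U : Opens X} (hp : p ∈ U)
    (hΦ : ContMDiffOn I 𝓘(ℝ, F) ∞ Φ U) (hf : ContMDiffOn I 𝓘(ℝ, ℝ) ∞ f U)
    (hs : Function.Surjective (tderiv I Φ p))
    (hker : ∀ x ∈ U, ∀ v, tderiv I Φ x v = 0 → tderiv I f x v = 0) :
    ∃ (O : Opens F) (k : F → ℝ), Φ p ∈ O ∧ ContDiffOn ℝ ∞ k O ∧
      ∀ᶠ q in 𝓝 p, Φ q ∈ O ∧ f q = k (Φ q) := by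
  rw [contMDiffOn_opens_iff] at hΦ hf
  have hps := mem_extChartAt_source (I := I) p
  set c := extChartAt I p with hc
  have hinv : c.symm (c p) = p := c.left_inv hps
  have hopen : IsOpen (c.target ∩ c.symm ⁻¹' U) :=
    (continuousOn_extChartAt_symm p).isOpen_inter_preimage (isOpen_extChartAt_target p) U.isOpen
  have key : ∀ y ∈ c.target ∩ c.symm ⁻¹' U, c.symm y ∈ c.source ∧ c.symm y ∈ U ∧
      c (c.symm y) = y := fun y hy ↦ ⟨c.map_target hy.1, hy.2, c.right_inv hy.1⟩
  obtain ⟨O, k, hO, hpO, hk, hev⟩ := exists_eq_comp_of_ker_fderiv_le (Φ := Φ ∘ c.symm)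
    (f := f ∘ c.symm) (x₀ := c p) hopen ⟨c.map_source hps, by simpa [hinv] using hp⟩
    (fun y hy ↦ by
      obtain ⟨h1, h2, h3⟩ := key y hy
      have := (tderiv_eq_fderiv_comp h1 (hΦ _ h2)).1
      rw [← hc, h3] at this
      exact this.contDiffWithinAt)
    (fun y hy ↦ by
      obtain ⟨h1, h2, h3⟩ := key y hy
      have := (tderiv_eq_fderiv_comp h1 (hf _ h2)).1
      rw [← hc, h3] at this
      exact this.contDiffWithinAt)
    (fun w ↦ by
      obtain ⟨v, hv⟩ := hs w
      exact ⟨_, ((tderiv_eq_fderiv_comp hps (hΦ p hp)).2 v).symm.trans hv⟩)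
    (fun y hy u hu ↦ by
      obtain ⟨h1, h2, h3⟩ := key y hy
      obtain ⟨v, hv⟩ := (bijective_tderiv_chart h1).2 u
      have e1 := (tderiv_eq_fderiv_comp h1 (hΦ _ h2)).2 v
      have e2 := (tderiv_eq_fderiv_comp h1 (hf _ h2)).2 v
      rw [← hc] at hv e1 e2
      rw [hv, h3] at e1 e2
      rw [← e2]
      exact hker _ h2 v (e1.trans hu))
  refine ⟨⟨O, hO⟩, k, by simpa [hinv] using hpO, hk, ?_⟩
  filter_upwards [(continuousAt_extChartAt (I := I) p).eventually hev,
    extChartAt_source_mem_nhds (I := I) p] with q hq hqs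
  have : c.symm (c q) = q := c.left_inv hqs
  rw [← hc] at hq
  simpa [this] using hq

end Submersion


/-! ### Orbit maps and the infinitesimal description of invariants. -/

section SmoothAction

variable {EG : Type*} [NormedAddCommGroup EG] [NormedSpace ℝ EG]
  (G : Type*) [TopologicalSpace G] [ChartedSpace EG G] [Group G]
  {E H : Type*} [NormedAddCommGroup E] [NormedSpace ℝ E] [TopologicalSpace H]
  {I : ModelWithCorners ℝ E H} {X : Type*} [TopologicalSpace X] [ChartedSpace H X] [MulAction G X]
  {V : Type*} [NormedAddCommGroup V] [NormedSpace ℝ V]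

variable (EG I) in
/-- The differential at `1` of the orbit map `g ↦ g • q`. -/
def orbitTangent (q : X) : EG →L[ℝ] E := mfderiv 𝓘(ℝ, EG) I (fun g : G ↦ g • q) 1

-- The generators at `q` already form a subspace, being the range of a linear map of the Lie
-- algebra.
variable (EG I) in
theorem orbitDistribution_eq_range (q : X) :
    orbitDistribution 𝓘(ℝ, EG) G I q = LinearMap.range (orbitTangent EG G I q).toLinearMap :=
  Submodule.span_eq (LinearMap.range (orbitTangent EG G I q).toLinearMap)

variable {G} [ContMDiffSMul 𝓘(ℝ, EG) I ∞ G X]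

theorem contMDiff_orbitMap (q : X) : ContMDiff 𝓘(ℝ, EG) I ∞ (fun g : G ↦ g • q) :=
  (contMDiff_smul (I := 𝓘(ℝ, EG)) (I' := I)).comp (contMDiff_id.prodMk contMDiff_const)

theorem mfderiv_comp_orbitMap {E' H' Y : Type*} [NormedAddCommGroup E'] [NormedSpace ℝ E']
    [TopologicalSpace H'] {I' : ModelWithCorners ℝ E' H'} [TopologicalSpace Y] [ChartedSpace H' Y]
    {F : X → Y} {q : X} (hF : MDifferentiableAt I I' F q) (A : EG) :
    (mfderiv 𝓘(ℝ, EG) I' (fun g : G ↦ F (g • q)) 1 : EG →L[ℝ] E') A =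
      (mfderiv I I' F q : E →L[ℝ] E') (orbitTangent EG G I q A) := by
  have hF' : MDifferentiableAt I I' F ((1 : G) • q) := by rwa [one_smul]
  have h := mfderiv_comp_apply (1 : G) hF' ((contMDiff_orbitMap q).mdifferentiableAt (by simp)) A
  refine h.trans ?_
  -- The chain rule gives the derivative of `F` at `1 • q`, which equals `q` only propositionally;
  -- the base point has to be transported.
  have e : ∀ y, y = q → ∀ w : E, (mfderiv I I' F y : E →L[ℝ] E') w =
      (mfderiv I I' F q : E →L[ℝ] E') w := by
    rintro _ rfl w
    rfl
  exact e _ (one_smul G q) _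

theorem tderiv_comp_orbitMap {F : X → V} {q : X} (hF : MDifferentiableAt I 𝓘(ℝ, V) F q) :
    tderiv 𝓘(ℝ, EG) (fun g : G ↦ F (g • q)) 1 = (tderiv I F q).comp (orbitTangent EG G I q) :=
  ContinuousLinearMap.ext fun A ↦ mfderiv_comp_orbitMap hF A

variable [LieGroup 𝓘(ℝ, EG) ∞ G]

/-- Right translation carries the derivative of `g ↦ f (g • q)` at any `g` to that of an orbit map
at `1`, based at `g • q`. If the generators kill `f`, this function on the group has zero derivative
and is locally constant. -/
theorem mem_localInvariants_iff [FiniteDimensional ℝ EG] [ContinuousSMul G X] {U : Opens X}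
    {f : X → ℝ} :
    f ∈ (localInvariants 𝓘(ℝ, EG) G I X).sections U ↔ ContMDiffOn I 𝓘(ℝ, ℝ) ∞ f U ∧
      ∀ q ∈ U, ∀ A : EG, tderiv I f q (orbitTangent EG G I q A) = 0 := by
  have : IsManifold 𝓘(ℝ, EG) ∞ G := ContMDiffMul.toIsManifold
  have : IsTopologicalGroup G := topologicalGroup_of_lieGroup 𝓘(ℝ, EG) ∞
  refine and_congr_right fun hf ↦ ⟨fun h q hq A ↦ ?_, fun h q hq ↦ ?_⟩
  · have hf' := ((contMDiffOn_opens_iff.1 hf q hq).mdifferentiableAt (by simp))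
    have h1 := (IsLocallyConstant.iff_eventually_eq _).1 (h q hq) ⟨1, by simpa using hq⟩
    have hU : ∀ᶠ a : G in 𝓝 1, a • q ∈ U :=
      (contMDiff_orbitMap (EG := EG) (I := I) q).continuous.continuousAt.eventually
        (U.isOpen.mem_nhds (by simpa using hq))
    rw [nhds_subtype_eq_comap, eventually_comap] at h1
    have h2 : (fun g : G ↦ f (g • q)) =ᶠ[𝓝 1] fun _ ↦ f q := by
      filter_upwards [h1, hU] with a ha ha'
      simpa using ha ⟨a, ha'⟩ rfl
    rw [← ContinuousLinearMap.comp_apply, ← tderiv_comp_orbitMap hf', tderiv_congr h2]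
    exact congrArg (fun T : EG →L[ℝ] ℝ ↦ T A) mfderiv_const
  · rw [IsLocallyConstant.iff_eventually_eq]
    rintro ⟨g₀, hg₀⟩
    have hc := (contMDiff_orbitMap (G := G) (EG := EG) (I := I) q)
    set W : Opens G := ⟨{g | g • q ∈ U}, U.isOpen.preimage hc.continuous⟩ with hW
    have hφ : ContMDiffOn 𝓘(ℝ, EG) 𝓘(ℝ, ℝ) ∞ (fun g : G ↦ f (g • q)) W :=
      hf.comp hc.contMDiffOn fun g hg ↦ hg
    have hd : ∀ g ∈ W, tderiv 𝓘(ℝ, EG) (fun g : G ↦ f (g • q)) g = 0 := by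
      intro g hg
      have h1 : tderiv 𝓘(ℝ, EG) (fun a : G ↦ f (a • g • q)) (g * g⁻¹) = 0 := by
        rw [mul_inv_cancel, tderiv_comp_orbitMap
          ((contMDiffOn_opens_iff.1 hf _ hg).mdifferentiableAt (by simp))]
        exact ContinuousLinearMap.ext fun A ↦ h _ hg A
      have h2 : MDifferentiableAt 𝓘(ℝ, EG) 𝓘(ℝ, ℝ) (fun a : G ↦ f (a • g • q)) (g * g⁻¹) := by
        have h3 : ContMDiffAt 𝓘(ℝ, EG) 𝓘(ℝ, ℝ) ∞ (fun a : G ↦ f (a • g • q)) (g * g⁻¹) :=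
          ContMDiffAt.comp (g := f) (f := fun a : G ↦ a • g • q) _
            (contMDiffOn_opens_iff.1 hf _ (by rw [mul_inv_cancel, one_smul]; exact hg))
            (contMDiff_orbitMap (g • q)).contMDiffAt
        exact h3.mdifferentiableAt (by simp)
      have h4 : MDifferentiableAt 𝓘(ℝ, EG) 𝓘(ℝ, EG) (fun a : G ↦ a * g⁻¹) g :=
        (contMDiff_mul_right (I := 𝓘(ℝ, EG)) (n := ∞) (a := g⁻¹)).mdifferentiableAt (by simp)
      have h5 : (fun g : G ↦ f (g • q)) = (fun a : G ↦ f (a • g • q)) ∘ fun a : G ↦ a * g⁻¹ :=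
        funext fun a ↦ by simp [smul_smul]
      ext A
      rw [h5]
      refine (mfderiv_comp_apply g h2 h4 A).trans ?_
      exact congrArg (fun T : EG →L[ℝ] ℝ ↦ T (mfderiv 𝓘(ℝ, EG) 𝓘(ℝ, EG)
        (fun a : G ↦ a * g⁻¹) g A)) h1
    -- The map to the zero-dimensional space is a submersion whose kernel is everything; a function
    -- that factors locally through it is locally constant.
    obtain ⟨O, k, -, -, hk⟩ := exists_eq_comp_of_ker_tderiv_le (F := Fin 0 → ℝ)
      (Φ := fun _ ↦ 0) (U := W) (p := g₀) hg₀ contMDiffOn_const hφ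
      (fun w ↦ ⟨0, Subsingleton.elim _ _⟩) (fun x hx v _ ↦ by rw [hd x hx]; rfl)
    rw [nhds_subtype_eq_comap, eventually_comap]
    filter_upwards [hk] with a ha b hab
    subst hab
    exact ha.2.trans hk.self_of_nhds.2.symm

variable [IsManifold I ∞ X]

theorem contMDiffOn_tderiv_orbitMap {F : X → V} {U : Opens X}
    (hF : ContMDiffOn I 𝓘(ℝ, V) ∞ F U) :
    ContMDiffOn I 𝓘(ℝ, EG →L[ℝ] V) ∞
      (fun q ↦ tderiv 𝓘(ℝ, EG) (fun g : G ↦ F (g • q)) 1) U := by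
  rw [contMDiffOn_opens_iff] at hF ⊢
  intro q hq
  have : IsManifold I 1 X := IsManifold.of_le (n := ∞) (by simp)
  have : IsManifold 𝓘(ℝ, EG) ∞ G := ContMDiffMul.toIsManifold
  have : IsManifold 𝓘(ℝ, EG) 1 G := IsManifold.of_le (n := ∞) (by simp)
  have h1 : ContMDiffAt (I.prod 𝓘(ℝ, EG)) I ∞ (fun z : X × G ↦ z.2 • z.1) (q, 1) :=
    ((contMDiff_smul (I := 𝓘(ℝ, EG)) (I' := I)).comp
      (contMDiff_snd.prodMk contMDiff_fst)).contMDiffAt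
  have h2 : ContMDiffAt (I.prod 𝓘(ℝ, EG)) 𝓘(ℝ, V) ∞
      (Function.uncurry fun (q : X) (g : G) ↦ F (g • q)) (q, 1) :=
    ContMDiffAt.comp (g := F) (f := fun z : X × G ↦ z.2 • z.1) (q, (1 : G))
      (by simpa using hF q hq) h1
  have h3 := ContMDiffAt.mfderiv (fun (q : X) (g : G) ↦ F (g • q)) (fun _ ↦ (1 : G)) h2
    contMDiffAt_const (m := ∞) (by simp)
  -- The smooth family `h3` is expressed in a trivialization of the tangent bundle of the group at
  -- `1`; composing with `T` undoes this change of coordinates. On the side of `V` the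
  -- trivialization is the identity.
  set T : EG →L[ℝ] EG :=
    (trivializationAt EG (TangentSpace 𝓘(ℝ, EG)) (1 : G)).continuousLinearMapAt ℝ 1 with hT
  have h4 := ContMDiffAt.clm_comp (F₁ := EG) (F₂ := EG) (F₃ := V) h3 (contMDiffAt_const (c := T))
  refine h4.congr_of_eventuallyEq (Filter.Eventually.of_forall fun y ↦ ?_)
  have e₁ := TangentBundle.continuousLinearMapAt_model_space (𝕜 := ℝ)
    (F ((1 : G) • q)) (F ((1 : G) • y))
  ext A
  have e₂ : ((trivializationAt EG (TangentSpace 𝓘(ℝ, EG)) (1 : G)).symmL ℝ 1 : EG →L[ℝ] EG)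
      (T A) = A :=
    (trivializationAt EG (TangentSpace 𝓘(ℝ, EG)) (1 : G)).symmL_continuousLinearMapAt
      (FiberBundle.mem_baseSet_trivializationAt' (1 : G)) A
  have e₃ := congrArg (fun S : V →L[ℝ] V ↦
    S (tderiv 𝓘(ℝ, EG) (fun g : G ↦ F (g • y)) 1 (((trivializationAt EG (TangentSpace 𝓘(ℝ, EG))
      (1 : G)).symmL ℝ 1 : EG →L[ℝ] EG)
      (T A)))) e₁
  refine (e₃.trans ?_).symm
  exact congrArg (tderiv 𝓘(ℝ, EG) (fun g : G ↦ F (g • y)) 1) e₂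

end SmoothAction


/-! ### Independent covectors and the rank of the orthogonal distribution. -/

section Independent

variable {E H : Type*} [NormedAddCommGroup E] [NormedSpace ℝ E] [TopologicalSpace H]
  {I : ModelWithCorners ℝ E H} {X : Type*} [TopologicalSpace X] [ChartedSpace H X]

theorem surjective_pi_of_linearIndependent {r : ℕ} {δ : Fin r → E →L[ℝ] ℝ}
    (h : LinearIndependent ℝ δ) : Function.Surjective (ContinuousLinearMap.pi δ) := by
  by_contra hn
  have hlt : LinearMap.range (ContinuousLinearMap.pi δ).toLinearMap < ⊤ :=
    lt_top_iff_ne_top.2 fun ht ↦ hn (LinearMap.range_eq_top.1 ht)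
  -- A nonzero functional vanishing on a proper image has as coefficients a linear relation between
  -- the `δ j`.
  obtain ⟨f, hf, hle⟩ := Submodule.exists_le_ker_of_lt_top _ hlt
  refine hf ?_
  have h0 : ∀ j, f (fun k ↦ if j = k then 1 else 0) = 0 := by
    refine Fintype.linearIndependent_iff.1 h _ ?_
    ext v
    have h1 : f (ContinuousLinearMap.pi δ v) = 0 := hle ⟨v, rfl⟩
    rw [LinearMap.pi_apply_eq_sum_univ] at h1
    simpa [mul_comm] using h1
  refine LinearMap.ext fun w ↦ ?_
  rw [LinearMap.pi_apply_eq_sum_univ]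
  simp [h0]

theorem sum_smul_apply_eq_zero {r : ℕ} (c : Fin r → ℝ) {δ : Fin r → E →L[ℝ] ℝ} {v : E}
    (h : ∀ j, δ j v = 0) : (∑ j, c j • δ j) v = 0 := by
  simp [h]

variable [FiniteDimensional ℝ E]

theorem finrank_ker_of_surjective {r : ℕ} {T : E →L[ℝ] Fin r → ℝ} (h : Function.Surjective T) :
    r + Module.finrank ℝ (LinearMap.ker T.toLinearMap) = Module.finrank ℝ E := by
  have h1 := LinearMap.finrank_range_add_finrank_ker T.toLinearMap
  rw [LinearMap.range_eq_top.2 h, finrank_top] at h1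
  simpa using h1

theorem finrank_perp_of_isRegularAt [IsManifold I ∞ X] {S : PfaffSystem I X} {r : ℕ} {x : X}
    (h : S.IsRegularAt r x) : r + Module.finrank ℝ (S.perp x : Submodule ℝ E) =
      Module.finrank ℝ E := by
  obtain ⟨U, θ, hxU, hθ, hind, hgen⟩ := h
  set δ : Fin r → E →L[ℝ] ℝ := fun j ↦ θ j x
  have hind' : LinearIndependent ℝ δ := hind
  rw [← finrank_ker_of_surjective (surjective_pi_of_linearIndependent hind')]
  -- The `r` generators of the stalk determine the values at `x` of all sections, so their common
  -- kernel is the whole orthogonal space.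
  have : (S.perp x : Submodule ℝ E) = LinearMap.ker (ContinuousLinearMap.pi δ).toLinearMap := by
    refine le_antisymm (fun v hv ↦ funext fun j ↦ hv U hxU _ (hθ j)) fun v hv V hxV η hη ↦ ?_
    obtain ⟨V', -, hxV', c, -, hs⟩ := hgen V hxV η hη
    rw [hs x hxV']
    exact sum_smul_apply_eq_zero (fun j ↦ c j x) (δ := δ) fun j ↦ congrFun hv j
  exact congrArg (fun P : Submodule ℝ E ↦ r + Module.finrank ℝ P) this

end Independent

/-! ### Dimension of the orbit directions and their detection by forms. -/

section Rank

variable {EG : Type*} [NormedAddCommGroup EG] [NormedSpace ℝ EG]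
  {G : Type*} [TopologicalSpace G] [ChartedSpace EG G] [Group G]
  {E H : Type*} [NormedAddCommGroup E] [NormedSpace ℝ E] [TopologicalSpace H]
  {I : ModelWithCorners ℝ E H} {X : Type*} [TopologicalSpace X] [ChartedSpace H X] [MulAction G X]

variable (EG G I) in
/-- The distribution spanned by the infinitesimal generators, as a family of subspaces of the model
space. -/
def orbitDirections (q : X) : Submodule ℝ E := LinearMap.range (orbitTangent EG G I q).toLinearMap

variable [IsManifold I ∞ X]

theorem orbitDistribution_le_perp (q : X) :
    orbitDistribution 𝓘(ℝ, EG) G I q ≤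
      (PfaffSystem.ofDistribution (orbitDistribution 𝓘(ℝ, EG) G I)).perp q := by
  intro v hv U hq η hη
  exact hη.2 q hq v hv

variable [ContMDiffSMul 𝓘(ℝ, EG) I ∞ G X]

variable (EG G I) in
/-- The differential at `1` of the orbit map of `q`, in the chart at `p`. -/
def chartOrbitTangent (p q : X) : EG →L[ℝ] E :=
  tderiv 𝓘(ℝ, EG) (fun g : G ↦ extChartAt I p (g • q)) 1

theorem chartOrbitTangent_eq {p q : X} (hq : q ∈ (extChartAt I p).source) :
    chartOrbitTangent EG G I p q =
      (tderiv I (extChartAt I p) q).comp (orbitTangent EG G I q) :=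
  tderiv_comp_orbitMap (mdifferentiableAt_chart hq)

theorem finrank_range_chartOrbitTangent {p q : X} (hq : q ∈ (extChartAt I p).source) :
    Module.finrank ℝ (LinearMap.range (chartOrbitTangent EG G I p q).toLinearMap) =
      Module.finrank ℝ (orbitDirections EG G I q) := by
  rw [chartOrbitTangent_eq hq, orbitDirections]
  have : LinearMap.range ((tderiv I (extChartAt I p) q).comp (orbitTangent EG G I q)).toLinearMap =
      (LinearMap.range (orbitTangent EG G I q).toLinearMap).map
        (tderiv I (extChartAt I p) q).toLinearMap := LinearMap.range_comp _ _
  rw [this]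
  exact (Submodule.equivMapOfInjective _ (bijective_tderiv_chart hq).1 _).finrank_eq.symm

variable [LieGroup 𝓘(ℝ, EG) ∞ G]

theorem contMDiffOn_chartOrbitTangent (p : X) :
    ContMDiffOn I 𝓘(ℝ, EG →L[ℝ] E) ∞ (chartOrbitTangent EG G I p) (extChartAt I p).source :=
  contMDiffOn_tderiv_orbitMap (U := ⟨(extChartAt I p).source, isOpen_extChartAt_source p⟩)
    (by simpa using contMDiffOn_extChartAt (I := I) (n := ∞) (x := p))

variable [FiniteDimensional ℝ E]

/-- Read in a fixed chart, the orbit tangents are a continuous family of linear maps between fixed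
spaces, and rank is lower semicontinuous. -/
theorem eventually_finrank_orbitDirections_le (p : X) :
    ∀ᶠ q in 𝓝 p, Module.finrank ℝ (orbitDirections EG G I p) ≤
      Module.finrank ℝ (orbitDirections EG G I q) := by
  have hp := mem_extChartAt_source (I := I) p
  have hc : ContinuousAt (chartOrbitTangent EG G I p) p :=
    (contMDiffOn_chartOrbitTangent p).continuousOn.continuousAt (extChartAt_source_mem_nhds p)
  have hmem : chartOrbitTangent EG G I p p ∈ {f : EG →L[ℝ] E |
      ((Module.finrank ℝ (orbitDirections EG G I p) : ℕ) : Cardinal) ≤ (f : EG →ₗ[ℝ] E).rank} := by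
    rw [mem_ofPred_eq, ← finrank_range_chartOrbitTangent hp, LinearMap.rank,
      ← Module.finrank_eq_rank]
  filter_upwards [hc ((isOpen_setOfPred_nat_le_rank (𝕜 := ℝ) (E := EG) (F := E)
    _).mem_nhds hmem), extChartAt_source_mem_nhds (I := I) p] with q hq hqs
  rw [← finrank_range_chartOrbitTangent hqs]
  rwa [mem_preimage, mem_ofPred_eq, LinearMap.rank, ← Module.finrank_eq_rank, Nat.cast_le] at hq

/-- The smooth `1`-forms that vanish on a distribution of locally constant rank spanned by
infinitesimal generators detect this distribution. -/
theorem perp_eq_of_eventually_finrank_le {q : X}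
    (h : ∀ᶠ y in 𝓝 q, Module.finrank ℝ (orbitDirections EG G I y) ≤
      Module.finrank ℝ (orbitDirections EG G I q)) :
    (PfaffSystem.ofDistribution (orbitDistribution 𝓘(ℝ, EG) G I)).perp q =
      orbitDistribution 𝓘(ℝ, EG) G I q := by
  refine le_antisymm (fun v hv ↦ ?_) (orbitDistribution_le_perp q)
  have hqs := mem_extChartAt_source (I := I) q
  set S := LinearMap.range (chartOrbitTangent EG G I q q).toLinearMap with hS
  obtain ⟨T₀, hT₀⟩ := LinearMap.exists_rightInverse_of_surjective
    (chartOrbitTangent EG G I q q).toLinearMap.rangeRestrict (LinearMap.range_rangeRestrict _)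
  set T : S →L[ℝ] EG := T₀.toContinuousLinearMap
  have hT : ∀ s : S, chartOrbitTangent EG G I q q (T s) = s := fun s ↦
    congrArg Subtype.val (DFunLike.congr_fun hT₀ s)
  obtain ⟨P, hP⟩ := Submodule.ClosedComplemented.of_finiteDimensional_quotient
    (p := S) (Submodule.closed_of_finiteDimensional _)
  -- `Y y` follows the orbit directions at `y` by a frame parametrized by `S`, the directions at
  -- `q`; near `q` it stays transverse to the kernel of `P`, which is the invertibility of `Z y`.
  set Y : X → S →L[ℝ] E := fun y ↦ (chartOrbitTangent EG G I q y).comp T with hY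
  set Z : X → S →L[ℝ] S := fun y ↦ P.comp (Y y) with hZ
  have hYs : ContMDiffOn I 𝓘(ℝ, S →L[ℝ] E) ∞ Y (extChartAt I q).source :=
    (contMDiffOn_chartOrbitTangent q).clm_comp contMDiffOn_const
  have hZs : ContMDiffOn I 𝓘(ℝ, S →L[ℝ] S) ∞ Z (extChartAt I q).source :=
    contMDiffOn_const.clm_comp hYs
  have hZq : Z q = ContinuousLinearMap.id ℝ S := by
    ext s
    simp only [hZ, hY, ContinuousLinearMap.comp_apply, hT, hP]
    rfl
  have hinv : ∀ᶠ y in 𝓝 q, Z y ∈ range ((↑) : (S ≃L[ℝ] S) → S →L[ℝ] S) := by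
    have hc : ContinuousAt Z q := hZs.continuousOn.continuousAt (extChartAt_source_mem_nhds q)
    refine hc ?_
    rw [hZq]
    exact ContinuousLinearEquiv.nhds (ContinuousLinearEquiv.refl ℝ S)
  obtain ⟨V, hV, hVo, hqV⟩ := eventually_nhds_iff.1
    (hinv.and (h.and (extChartAt_source_mem_nhds (I := I) q)))
  set V' : Opens X := ⟨V, hVo⟩
  have hVs : V ⊆ (extChartAt I q).source := fun y hy ↦ (hV y hy).2.2
  have hker : ∀ ξ : E →L[ℝ] ℝ, (∀ w ∈ S, ξ w = 0) → ξ (tderiv I (extChartAt I q) q v) = 0 := by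
    intro ξ hξ
    -- `Y y ∘ (Z y)⁻¹ ∘ P` projects onto the range of `Y y` along the kernel of `P`. Subtracting `ξ`
    -- composed with it extends `ξ` to covectors that kill the orbit directions at every nearby
    -- point.
    set a : X → E →L[ℝ] ℝ := fun y ↦ ξ - ((ξ.comp (Y y)).comp (Z y).inverse).comp P with ha
    have has : ContMDiffOn I 𝓘(ℝ, E →L[ℝ] ℝ) ∞ a V' := by
      refine contMDiffOn_const.sub (ContMDiffOn.clm_comp (ContMDiffOn.clm_comp
        (contMDiffOn_const.clm_comp (hYs.mono hVs)) ?_) contMDiffOn_const)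
      rw [contMDiffOn_opens_iff]
      intro y hy
      obtain ⟨e, he⟩ := (hV y hy).1
      have h1 : ContDiffAt ℝ ∞ ContinuousLinearMap.inverse (Z y) := by
        rw [← he]
        exact contDiffAt_map_inverse e
      exact h1.contMDiffAt.comp y
        (hZs.contMDiffAt ((isOpen_extChartAt_source q).mem_nhds (hVs hy)))
    have hη : formOfChart q a ∈
        (PfaffSystem.ofDistribution (orbitDistribution 𝓘(ℝ, EG) G I)).sections V' := by
      refine ⟨smoothOn_formOfChart hVs has, fun y hy w hw ↦ ?_⟩
      rw [orbitDistribution_eq_range] at hw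
      obtain ⟨A, rfl⟩ := hw
      obtain ⟨⟨e, he⟩, h2, h3⟩ := hV y hy
      change a y (tderiv I (extChartAt I q) y (orbitTangent EG G I y A)) = 0
      rw [← ContinuousLinearMap.comp_apply (tderiv I (extChartAt I q) y), ← chartOrbitTangent_eq h3]
      have hinj : Function.Injective (Y y) := fun s t hst ↦ e.injective (by
        rw [← ContinuousLinearEquiv.coe_coe, he]
        exact congrArg P hst)
      -- Here the dimension bound enters: without it the range of `Y y` could be a proper part of
      -- the orbit directions.
      have hr : LinearMap.range (Y y).toLinearMap =
          LinearMap.range (chartOrbitTangent EG G I q y).toLinearMap := by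
        refine Submodule.eq_of_le_of_finrank_le (LinearMap.range_comp_le_range _ _) ?_
        rw [finrank_range_chartOrbitTangent h3, LinearMap.finrank_range_of_inj hinj, hS,
          finrank_range_chartOrbitTangent hqs]
        exact h2
      obtain ⟨s, hs⟩ : chartOrbitTangent EG G I q y A ∈ LinearMap.range (Y y).toLinearMap :=
        hr ▸ ⟨A, rfl⟩
      rw [← hs]
      have h4 : (Z y).inverse (P (Y y s)) = s := by
        change (Z y).inverse (Z y s) = s
        rw [← he, ContinuousLinearMap.inverse_equiv]
        exact e.symm_apply_apply s
      change ξ (Y y s) - ξ (Y y ((Z y).inverse (P (Y y s)))) = 0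
      rw [h4, sub_self]
    have h5 : a q (tderiv I (extChartAt I q) q v) = 0 := hv V' hqV _ hη
    have h6 : ∀ w, a q w = ξ w := fun w ↦ by
      change ξ w - ξ (chartOrbitTangent EG G I q q (T ((Z q).inverse (P w)))) = ξ w
      rw [hT, hξ _ (Subtype.mem _), sub_zero]
    rw [← h6, h5]
  have hvS : tderiv I (extChartAt I q) q v ∈ S := by
    by_contra hn
    obtain ⟨f, hf, hfS⟩ := Submodule.exists_le_ker_of_notMem hn
    exact hf (hker f.toContinuousLinearMap fun w hw ↦ hfS hw)
  obtain ⟨A, hA⟩ := hvS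
  have hA' : chartOrbitTangent EG G I q q A = tderiv I (extChartAt I q) q v := hA
  rw [chartOrbitTangent_eq hqs] at hA'
  rw [orbitDistribution_eq_range]
  exact ⟨A, (bijective_tderiv_chart hqs).1 hA'⟩

-- Dimensions are bounded natural numbers, so every nonempty open set has a point where the orbit
-- directions have maximal dimension in that set, and there `perp_eq_of_eventually_finrank_le`
-- applies.
variable (EG G I X) in
theorem dense_perp_eq :
    Dense {q : X | (PfaffSystem.ofDistribution (orbitDistribution 𝓘(ℝ, EG) G I)).perp q =
      orbitDistribution 𝓘(ℝ, EG) G I q} := by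
  rw [dense_iff_inter_open]
  intro U hU hne
  set s : Set ℕ := (fun q ↦ Module.finrank ℝ (orbitDirections EG G I q)) '' U with hs
  have hb : BddAbove s := ⟨Module.finrank ℝ E, by
    rintro _ ⟨q, -, rfl⟩
    exact Submodule.finrank_le _⟩
  obtain ⟨q, hqU, hq⟩ := Nat.sSup_mem (hne.image _) hb
  refine ⟨q, hqU, perp_eq_of_eventually_finrank_le ?_⟩
  filter_upwards [hU.mem_nhds hqU] with y hy
  exact (le_csSup hb ⟨y, hy, rfl⟩).trans hq.ge

/-- Regularity keeps the dimension of the orthogonal distribution locally constant, while that of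
the orbit directions inside it cannot drop nearby; equality at `q` thus forces equality around `q`.
-/
theorem isOpen_perp_eq {W : Opens X} (h : (PfaffSystem.ofDistribution
      (orbitDistribution 𝓘(ℝ, EG) G I)).IsRegularOn W) :
    IsOpen {q : X | q ∈ W ∧ (PfaffSystem.ofDistribution (orbitDistribution 𝓘(ℝ, EG) G I)).perp q =
      orbitDistribution 𝓘(ℝ, EG) G I q} := by
  rw [isOpen_iff_mem_nhds]
  rintro q ⟨hqW, hq⟩
  obtain ⟨U, r, hqU, hU⟩ := h q hqW
  filter_upwards [U.isOpen.mem_nhds hqU, W.isOpen.mem_nhds hqW,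
    eventually_finrank_orbitDirections_le (EG := EG) (G := G) (I := I) q] with y hyU hyW hy
  refine ⟨hyW, ?_⟩
  have h1 := finrank_perp_of_isRegularAt (hU q hqU)
  have h2 := finrank_perp_of_isRegularAt (hU y hyU)
  rw [hq] at h1
  rw [orbitDistribution_eq_range] at h1 ⊢
  have hle := orbitDistribution_le_perp (EG := EG) (G := G) (I := I) y
  rw [orbitDistribution_eq_range] at hle
  have h3 : Module.finrank ℝ (orbitDirections EG G I q) + r = Module.finrank ℝ E :=
    (add_comm _ _).trans h1
  have h4 : Module.finrank ℝ ((PfaffSystem.ofDistribution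
      (orbitDistribution 𝓘(ℝ, EG) G I)).perp y : Submodule ℝ E) ≤
      Module.finrank ℝ (orbitDirections EG G I y) := by omega
  have key : orbitDirections EG G I y = ((PfaffSystem.ofDistribution
      (orbitDistribution 𝓘(ℝ, EG) G I)).perp y : Submodule ℝ E) :=
    (fun (P Q : Submodule ℝ E) (h : P ≤ Q) (h' : Module.finrank ℝ Q ≤ Module.finrank ℝ P) ↦
      Submodule.eq_of_le_of_finrank_le h h') _ _ hle h4
  exact key.symm

end Rank


/-! ### Lifting joint invariants along the projections. -/

section Joint

theorem dense_iInter_of_isOpen_of_fintype {ι Y : Type*} [Fintype ι] [TopologicalSpace Y]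
    {s : ι → Set Y} (ho : ∀ i, IsOpen (s i)) (hd : ∀ i, Dense (s i)) : Dense (⋂ i, s i) := by
  classical
  have h : ∀ t : Finset ι, Dense (⋂ i ∈ t, s i) := by
    intro t
    induction t using Finset.induction_on with
    | empty => simp
    | insert a t ha ih =>
      rw [Finset.set_biInter_insert]
      exact (hd a).inter_of_isOpen_left ih (ho a)
  simpa using h Finset.univ

variable {EG : Type*} [NormedAddCommGroup EG] [NormedSpace ℝ EG]
  {G : Type*} [TopologicalSpace G] [ChartedSpace EG G] [Group G]
  {E : Type*} [NormedAddCommGroup E] [NormedSpace ℝ E]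
  {M : Type*} [TopologicalSpace M] [ChartedSpace E M]
  [MulAction G M] [ContMDiffSMul 𝓘(ℝ, EG) 𝓘(ℝ, E) ∞ G M] {n : ℕ}

theorem mfderiv_dropComponent_orbitTangent (i : Fin (n + 1)) (p : Fin (n + 1) → M) (A : EG) :
    (mfderiv (powModel E (n + 1)) (powModel E n) (dropComponent i) p :
      (Fin (n + 1) → E) →L[ℝ] (Fin n → E)) (orbitTangent EG G (powModel E (n + 1)) p A) =
      orbitTangent EG G (powModel E n) (dropComponent i p) A :=
  (mfderiv_comp_orbitMap
    ((contMDiff_dropComponent i (k := ∞)).mdifferentiableAt (by simp)) A).symm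

variable [LieGroup 𝓘(ℝ, EG) ∞ G]

/-- Dropping a component commutes with the diagonal action by definition, so local constancy along
orbits passes to the lift. -/
theorem comp_dropComponent_mem_jointInvariants {V : Opens (Fin n → M)} {h : (Fin n → M) → ℝ}
    (hh : h ∈ (jointInvariants E M n EG G).sections V) (i : Fin (n + 1)) :
    h ∘ dropComponent i ∈ (jointInvariants E M (n + 1) EG G).sections
      ⟨dropComponent i ⁻¹' V, V.isOpen.preimage (continuous_dropComponent i)⟩ :=
  ⟨hh.1.comp (contMDiff_dropComponent i).contMDiffOn fun _ hx ↦ hx,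
    fun p hp ↦ hh.2 (dropComponent i p) hp⟩

theorem comp_dropComponent_mem_pullback {V : Opens (Fin n → M)} {h : (Fin n → M) → ℝ}
    (hh : h ∈ (jointInvariants E M n EG G).sections V) (i : Fin (n + 1)) :
    h ∘ dropComponent i ∈ ((jointInvariants E M n EG G).pullback (I := powModel E (n + 1))
      (dropComponent i)).sections
      ⟨dropComponent i ⁻¹' V, V.isOpen.preimage (continuous_dropComponent i)⟩ :=
  ⟨(comp_dropComponent_mem_jointInvariants hh i).1, fun _ hx ↦
    ⟨_, le_rfl, hx, V, h, hh, fun _ hy ↦ ⟨hy, rfl⟩⟩⟩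

variable [FiniteDimensional ℝ EG]

theorem mem_jointInvariants_iff {U : Opens (Fin n → M)} {f : (Fin n → M) → ℝ} :
    f ∈ (jointInvariants E M n EG G).sections U ↔
      ContMDiffOn (powModel E n) 𝓘(ℝ, ℝ) ∞ f U ∧
      ∀ q ∈ U, ∀ A : EG, tderiv (powModel E n) f q (orbitTangent EG G (powModel E n) q A) = 0 :=
  have : ContinuousSMul G M := ContMDiffSMul.continuousSMul (I := 𝓘(ℝ, EG)) (I' := 𝓘(ℝ, E)) ∞
  mem_localInvariants_iff

variable [IsManifold 𝓘(ℝ, E) ∞ M]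

theorem mem_jointInvariants_of_mem_liftedInvariants {U : Opens (Fin (n + 1) → M)}
    {f : (Fin (n + 1) → M) → ℝ} (hf : f ∈ (liftedInvariants E M n EG G).sections U) :
    f ∈ (jointInvariants E M (n + 1) EG G).sections U := by
  refine mem_jointInvariants_iff.2 ⟨hf.1, fun q hq A ↦ ?_⟩
  obtain ⟨V, hVU, hqV, r, θ, hθ, c, -, hs⟩ := hf.2.2 q hq
  have hz : ∀ j, (θ j q : (Fin (n + 1) → E) →L[ℝ] ℝ)
      (orbitTangent EG G (powModel E (n + 1)) q A) = 0 := by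
    intro j
    obtain ⟨V', hVV', ⟨i, f', hf', he⟩, -⟩ := hθ j
    obtain ⟨V₁, -, hqV₁, V₂, h, hh, hV⟩ := hf'.2 q (hVV' hqV)
    have h1 : tderiv (powModel E (n + 1)) f' q =
        tderiv (powModel E (n + 1)) (h ∘ dropComponent i) q :=
      tderiv_congr (Filter.eventuallyEq_of_mem (V₁.isOpen.mem_nhds hqV₁) fun y hy ↦ (hV y hy).2)
    rw [he]
    change tderiv (powModel E (n + 1)) f' q _ = 0
    rw [h1]
    exact (mem_jointInvariants_iff.1 (comp_dropComponent_mem_jointInvariants hh i)).2 q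
      (hV q hqV₁).1 A
  have h2 : tderiv (powModel E (n + 1)) f q =
      ∑ j, c j q • (θ j q : (Fin (n + 1) → E) →L[ℝ] ℝ) := hs q hqV
  rw [h2]
  exact sum_smul_apply_eq_zero (fun j ↦ c j q) hz

/-- First integrals of the Pfaff system are joint invariants, both being the functions killed by the
generators. By integrability their differentials generate every section near `x`, so a vector killed
by them is orthogonal. -/
theorem mem_perp_of_tderiv_eq_zero {W : Opens (Fin n → M)}
    (hint : (jointPfaff E M n EG G).IsIntegrableOn W) {x : Fin n → M} (hx : x ∈ W) {v : Fin n → E}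
    (hv : ∀ (V : Opens (Fin n → M)) (h : (Fin n → M) → ℝ), x ∈ V →
      h ∈ (jointInvariants E M n EG G).sections V → tderiv (powModel E n) h x v = 0) :
    v ∈ ((jointPfaff E M n EG G).perp x : Submodule ℝ (Fin n → E)) := by
  intro U hxU η hη
  have h1 := (jointPfaff E M n EG G).restrict (V := U ⊓ W) inf_le_left hη
  rw [← hint (U ⊓ W) inf_le_right] at h1
  obtain ⟨V, -, hxV, r, θ, hθ, c, -, hs⟩ := h1.2 x ⟨hxU, hx⟩
  have hz : ∀ j, (θ j x : (Fin n → E) →L[ℝ] ℝ) v = 0 := by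
    intro j
    obtain ⟨V', hVV', ⟨_, f, hf, he⟩, -⟩ := hθ j
    rw [he]
    refine hv V' f (hVV' hxV) (mem_jointInvariants_iff.2 ⟨hf.1, fun q hq A ↦ ?_⟩)
    exact hf.2.2 q hq _ (Submodule.subset_span ⟨A, rfl⟩)
  have h2 : (η x : (Fin n → E) →L[ℝ] ℝ) =
      ∑ j, c j x • (θ j x : (Fin n → E) →L[ℝ] ℝ) := hs x hxV
  exact (congrArg (fun T : (Fin n → E) →L[ℝ] ℝ ↦ T v) h2).trans
    (sum_smul_apply_eq_zero (fun j ↦ c j x) hz)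

variable [FiniteDimensional ℝ E]

/-- Near a generic point there are finitely many liftings of joint invariants whose differentials
are linearly independent and have the orbit directions as common kernel. -/
theorem exists_lifted_submersion {W : Opens (Fin n → M)}
    (hint : (jointPfaff E M n EG G).IsIntegrableOn W) {p : Fin (n + 1) → M}
    (hcond : ⨅ i : Fin (n + 1), (jointDistribution E EG G p ⊔
        LinearMap.ker (mfderiv (powModel E (n + 1)) (powModel E n)
          (dropComponent i) p).toLinearMap) = jointDistribution E EG G p)
    (hp : ∀ i : Fin (n + 1), dropComponent i p ∈ W ∧
      (jointPfaff E M n EG G).perp (dropComponent i p) =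
        jointDistribution E EG G (dropComponent i p)) :
    ∃ (r : ℕ) (i : Fin r → Fin (n + 1)) (V : Fin r → Opens (Fin n → M))
      (h : Fin r → (Fin n → M) → ℝ) (U : Opens (Fin (n + 1) → M)),
      (∀ j, h j ∈ (jointInvariants E M n EG G).sections (V j)) ∧ p ∈ U ∧
      (∀ q ∈ U, ∀ j, dropComponent (i j) q ∈ V j) ∧
      ContMDiffOn (powModel E (n + 1)) 𝓘(ℝ, Fin r → ℝ) ∞
        (fun q j ↦ h j (dropComponent (i j) q)) U ∧
      Function.Surjective
        (tderiv (powModel E (n + 1)) (fun q j ↦ h j (dropComponent (i j) q)) p) ∧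
      ∀ q ∈ U, ∀ v, tderiv (powModel E (n + 1)) (fun q j ↦ h j (dropComponent (i j) q)) q v = 0 →
        v ∈ orbitDirections EG G (powModel E (n + 1)) q := by
  set D : Set ((Fin (n + 1) → E) →L[ℝ] ℝ) := {δ | ∃ (i : Fin (n + 1)) (V : Opens (Fin n → M))
    (h : (Fin n → M) → ℝ), dropComponent i p ∈ V ∧ h ∈ (jointInvariants E M n EG G).sections V ∧
      δ = tderiv (powModel E (n + 1)) (h ∘ dropComponent i) p} with hD
  -- A basis of the span is chosen inside `D` itself, so that each basis covector is the
  -- differential of an actual lifted invariant.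
  obtain ⟨δ, hδD, hspan, hind⟩ := Submodule.exists_fun_fin_finrank_span_eq ℝ D
  choose i V h hpV hh hδ using hδD
  have hsm : ∀ j, ContMDiffOn (powModel E (n + 1)) 𝓘(ℝ, ℝ) ∞ (h j ∘ dropComponent (i j))
      (dropComponent (i j) ⁻¹' (V j)) := fun j ↦ (comp_dropComponent_mem_jointInvariants (hh j) _).1
  set Φ : (Fin (n + 1) → M) → Fin (Module.finrank ℝ (Submodule.span ℝ D)) → ℝ :=
    fun q j ↦ h j (dropComponent (i j) q) with hΦ
  set U₀ : Opens (Fin (n + 1) → M) := ⟨⋂ j, dropComponent (i j) ⁻¹' (V j),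
    isOpen_iInter_of_finite fun j ↦ (V j).isOpen.preimage (continuous_dropComponent _)⟩ with hU₀
  have hU₀V : ∀ q ∈ U₀, ∀ j, dropComponent (i j) q ∈ V j := fun q hq j ↦ mem_iInter.1 hq j
  have hpU₀ : p ∈ U₀ := mem_iInter.2 hpV
  have hΦs : ContMDiffOn (powModel E (n + 1)) 𝓘(ℝ, Fin _ → ℝ) ∞ Φ U₀ :=
    contMDiffOn_pi_space.2 fun j ↦ (hsm j).mono (iInter_subset _ j)
  have hcomp : ∀ q ∈ U₀, ∀ j v, tderiv (powModel E (n + 1)) Φ q v j =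
      tderiv (powModel E (n + 1)) (h j ∘ dropComponent (i j)) q v := by
    intro q hq j v
    have h1 := tderiv_comp (I := powModel E (n + 1)) (f := Φ) (x := q)
      (g := ContinuousLinearMap.proj (R := ℝ) (φ := fun _ ↦ ℝ) j)
      (ContinuousLinearMap.differentiableAt _)
      ((contMDiffOn_opens_iff.1 hΦs q hq).mdifferentiableAt (by simp))
    rw [ContinuousLinearMap.fderiv] at h1
    exact (congrArg (fun T : (Fin (n + 1) → E) →L[ℝ] ℝ ↦ T v) h1).symm
  have hpi : tderiv (powModel E (n + 1)) Φ p = ContinuousLinearMap.pi δ := by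
    ext1 v
    ext j
    rw [hcomp p hpU₀, ← hδ]
    rfl
  have hsurj : Function.Surjective (tderiv (powModel E (n + 1)) Φ p) := by
    rw [hpi]
    exact surjective_pi_of_linearIndependent hind
  have hle : ∀ q ∈ U₀, orbitDirections EG G (powModel E (n + 1)) q ≤
      LinearMap.ker (tderiv (powModel E (n + 1)) Φ q).toLinearMap := by
    rintro q hq _ ⟨A, rfl⟩
    refine funext fun j ↦ ?_
    exact (hcomp q hq j _).trans ((mem_jointInvariants_iff.1
      (comp_dropComponent_mem_jointInvariants (hh j) (i j))).2 q (hU₀V q hq j) A)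
  have hkerp : LinearMap.ker (tderiv (powModel E (n + 1)) Φ p).toLinearMap ≤
      orbitDirections EG G (powModel E (n + 1)) p := by
    intro v hv
    have hvD : ∀ δ' ∈ D, δ' v = 0 := by
      have h1 : Submodule.span ℝ D ≤ LinearMap.ker
          (ContinuousLinearMap.apply ℝ ℝ v : ((Fin (n + 1) → E) →L[ℝ] ℝ) →L[ℝ] ℝ).toLinearMap := by
        rw [← hspan, Submodule.span_le]
        rintro _ ⟨j, rfl⟩
        have h2 : tderiv (powModel E (n + 1)) Φ p v = 0 := hv
        rw [hpi] at h2
        exact congrFun h2 j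
      exact fun δ' hδ' ↦ h1 (Submodule.subset_span hδ')
    have key : v ∈ jointDistribution E EG G p := by
      refine hcond.le ((Submodule.mem_iInf _).2 fun k ↦ ?_)
      set T : (Fin (n + 1) → E) →L[ℝ] (Fin n → E) :=
        mfderiv (powModel E (n + 1)) (powModel E n) (dropComponent k) p
      have h3 : T v ∈ ((jointPfaff E M n EG G).perp (dropComponent k p) :
          Submodule ℝ (Fin n → E)) := by
        refine mem_perp_of_tderiv_eq_zero hint (hp k).1 fun V' h' hV' hh' ↦ ?_
        have h4 := hvD _ ⟨k, V', h', hV', hh', rfl⟩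
        rw [← h4]
        exact (mfderiv_comp_apply p
          ((contMDiffOn_opens_iff.1 hh'.1 _ hV').mdifferentiableAt (by simp))
          ((contMDiff_dropComponent k (k := ∞)).mdifferentiableAt (by simp)) v).symm
      rw [(hp k).2] at h3
      change T v ∈ orbitDistribution 𝓘(ℝ, EG) G (powModel E n) (dropComponent k p) at h3
      rw [orbitDistribution_eq_range] at h3
      obtain ⟨A, hA⟩ := h3
      -- The same `A` generates a vector at `p` with the same projection as `v`, so the difference
      -- lies in the kernel of the projection.
      refine Submodule.mem_sup.2 ⟨orbitTangent EG G (powModel E (n + 1)) p A,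
        Submodule.subset_span ⟨A, rfl⟩, v - orbitTangent EG G (powModel E (n + 1)) p A, ?_, ?_⟩
      · change T (v - orbitTangent EG G (powModel E (n + 1)) p A) = 0
        have h5 : T (orbitTangent EG G (powModel E (n + 1)) p A) =
            orbitTangent EG G (powModel E n) (dropComponent k p) A :=
          mfderiv_dropComponent_orbitTangent k p A
        rw [map_sub, h5, ← hA]
        exact sub_self _
      · exact add_sub_cancel (orbitTangent EG G (powModel E (n + 1)) p A) v
    change v ∈ orbitDistribution 𝓘(ℝ, EG) G (powModel E (n + 1)) p at key
    rwa [orbitDistribution_eq_range] at key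
  obtain ⟨U₁, hU₁, hU₁o, hpU₁⟩ := eventually_nhds_iff.1
    ((eventually_surjective_tderiv hpU₀ hΦs hsurj).and ((U₀.isOpen.eventually_mem hpU₀).and (
      eventually_finrank_orbitDirections_le (EG := EG) (G := G)
        (I := powModel E (n + 1)) p)))
  refine ⟨_, i, V, h, ⟨U₁, hU₁o⟩, hh, hpU₁, fun q hq ↦ hU₀V q (hU₁ q hq).2.1,
    hΦs.mono fun q hq ↦ (hU₁ q hq).2.1, hsurj, fun q hq v hv ↦ ?_⟩
  obtain ⟨h1, h2, h3⟩ := hU₁ q hq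
  -- With `K` the kernel of `dΦ`: `dim L_q ≥ dim L_p ≥ dim K_p = dim K_q`, while `L_q ≤ K_q`.
  have h4 := finrank_ker_of_surjective h1
  have h5 := finrank_ker_of_surjective hsurj
  have h6 := Submodule.finrank_mono hkerp
  have h7 : orbitDirections EG G (powModel E (n + 1)) q =
      LinearMap.ker (tderiv (powModel E (n + 1)) Φ q).toLinearMap :=
    Submodule.eq_of_le_of_finrank_le (hle q h2) (by omega)
  rw [h7]
  exact hv

end Joint


/-! ### Invariants near generic points and extension from dense sets. -/

section Generic

variable {EG : Type*} [NormedAddCommGroup EG] [NormedSpace ℝ EG] [FiniteDimensional ℝ EG]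
  {G : Type*} [TopologicalSpace G] [ChartedSpace EG G] [Group G] [LieGroup 𝓘(ℝ, EG) ∞ G]
  {E : Type*} [NormedAddCommGroup E] [NormedSpace ℝ E]
  {M : Type*} [TopologicalSpace M] [ChartedSpace E M] [IsManifold 𝓘(ℝ, E) ∞ M]
  [MulAction G M] [ContMDiffSMul 𝓘(ℝ, EG) 𝓘(ℝ, E) ∞ G M] {n : ℕ}

/-- The derivative of `f` along the generator of a fixed `A` is continuous on `U`, so it vanishes as
soon as it does on a dense subset. -/
theorem mem_jointInvariants_of_dense {W : Opens (Fin n → M)} (hW : Dense (W : Set (Fin n → M)))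
    {U : Opens (Fin n → M)} {f : (Fin n → M) → ℝ} (hf : ContMDiffOn (powModel E n) 𝓘(ℝ, ℝ) ∞ f U)
    (h : f ∈ (jointInvariants E M n EG G).sections (U ⊓ W)) :
    f ∈ (jointInvariants E M n EG G).sections U := by
  rw [mem_jointInvariants_iff] at h ⊢
  refine ⟨hf, fun q hq A ↦ ?_⟩
  have hc := contMDiffOn_tderiv_orbitMap (EG := EG) (G := G) hf
  have hc' : ContinuousAt (fun q ↦ tderiv 𝓘(ℝ, EG) (fun g : G ↦ f (g • q)) 1 A) q :=
    (hc.continuousOn.continuousAt (U.isOpen.mem_nhds hq)).clm_apply continuousAt_const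
  have he : ∀ y ∈ U, tderiv 𝓘(ℝ, EG) (fun g : G ↦ f (g • y)) 1 A =
      tderiv (powModel E n) f y (orbitTangent EG G (powModel E n) y A) := fun y hy ↦ by
    rw [tderiv_comp_orbitMap ((contMDiffOn_opens_iff.1 hf y hy).mdifferentiableAt (by simp))]
    rfl
  rw [← he q hq]
  by_contra hne
  obtain ⟨y, hyW, hy⟩ := hW.inter_nhds_nonempty
    (inter_mem (hc'.eventually_ne hne) (U.isOpen.mem_nhds hq))
  exact hy.1 ((he y hy.2).trans (h.2 y ⟨hy.2, hyW⟩ A))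

variable [FiniteDimensional ℝ E]

/-- A joint invariant is, near a generic point, a smooth function of finitely many liftings of joint
invariants of fewer points. -/
theorem exists_eq_comp_lifted {W : Opens (Fin n → M)}
    (hint : (jointPfaff E M n EG G).IsIntegrableOn W) {p : Fin (n + 1) → M}
    (hcond : ⨅ i : Fin (n + 1), (jointDistribution E EG G p ⊔
        LinearMap.ker (mfderiv (powModel E (n + 1)) (powModel E n)
          (dropComponent i) p).toLinearMap) = jointDistribution E EG G p)
    (hp : ∀ i : Fin (n + 1), dropComponent i p ∈ W ∧
      (jointPfaff E M n EG G).perp (dropComponent i p) =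
        jointDistribution E EG G (dropComponent i p))
    {U : Opens (Fin (n + 1) → M)} {f : (Fin (n + 1) → M) → ℝ}
    (hf : f ∈ (jointInvariants E M (n + 1) EG G).sections U) (hpU : p ∈ U) :
    ∃ (r : ℕ) (i : Fin r → Fin (n + 1)) (V : Fin r → Opens (Fin n → M))
      (h : Fin r → (Fin n → M) → ℝ) (O : Opens (Fin r → ℝ)) (F : (Fin r → ℝ) → ℝ)
      (U' : Opens (Fin (n + 1) → M)),
      (∀ j, h j ∈ (jointInvariants E M n EG G).sections (V j)) ∧ p ∈ U' ∧ U' ≤ U ∧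
      (∀ q ∈ U', ∀ j, dropComponent (i j) q ∈ V j) ∧
      ContMDiffOn (powModel E (n + 1)) 𝓘(ℝ, Fin r → ℝ) ∞
        (fun q j ↦ h j (dropComponent (i j) q)) U' ∧
      ContDiffOn ℝ ∞ F O ∧ ∀ q ∈ U', (fun j ↦ h j (dropComponent (i j) q)) ∈ O ∧
        f q = F (fun j ↦ h j (dropComponent (i j) q)) := by
  obtain ⟨r, i, V, h, U₁, hh, hpU₁, hV, hΦ, hsurj, hker⟩ := exists_lifted_submersion hint hcond hp
  rw [mem_jointInvariants_iff] at hf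
  obtain ⟨O, F, -, hF, hev⟩ := exists_eq_comp_of_ker_tderiv_le (p := p) (U := U₁ ⊓ U)
    ⟨hpU₁, hpU⟩ (hΦ.mono fun q hq ↦ hq.1) (hf.1.mono fun q hq ↦ hq.2) hsurj fun q hq v hv ↦ by
      obtain ⟨A, rfl⟩ := hker q hq.1 v hv
      exact hf.2 q hq.2 A
  obtain ⟨U₂, hU₂, hU₂o, hpU₂⟩ := eventually_nhds_iff.1 hev
  refine ⟨r, i, V, h, O, F, ⟨U₂, hU₂o⟩ ⊓ (U₁ ⊓ U), hh, ⟨hpU₂, hpU₁, hpU⟩,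
    inf_le_right.trans inf_le_right, fun q hq ↦ hV q hq.2.1, hΦ.mono fun q hq ↦ hq.2.1, hF,
    fun q hq ↦ hU₂ q hq.1⟩

/-- By the chain rule, `f = F ∘ Φ` makes `df` a combination of the differentials of the components
of `Φ`, with the smooth coefficients `∂F/∂xⱼ ∘ Φ`. -/
theorem mem_liftedInvariants_of_mem_jointInvariants {W : Opens (Fin n → M)}
    (hint : (jointPfaff E M n EG G).IsIntegrableOn W) {U : Opens (Fin (n + 1) → M)}
    (hcond : ∀ p ∈ U, ⨅ i : Fin (n + 1), (jointDistribution E EG G p ⊔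
        LinearMap.ker (mfderiv (powModel E (n + 1)) (powModel E n)
          (dropComponent i) p).toLinearMap) = jointDistribution E EG G p)
    (hU : ∀ p ∈ U, ∀ i : Fin (n + 1), dropComponent i p ∈ W ∧
      (jointPfaff E M n EG G).perp (dropComponent i p) =
        jointDistribution E EG G (dropComponent i p))
    {f : (Fin (n + 1) → M) → ℝ} (hf : f ∈ (jointInvariants E M (n + 1) EG G).sections U) :
    f ∈ (liftedInvariants E M n EG G).sections U := by
  refine ⟨hf.1, smoothOn_differential hf.1, fun p hpU ↦ ?_⟩
  obtain ⟨r, i, V, h, O, F, U', hh, hpU', hU'U, hV, hΦ, hF, hfF⟩ :=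
    exists_eq_comp_lifted hint (hcond p hpU) (hU p hpU) hf hpU
  set Φ : (Fin (n + 1) → M) → Fin r → ℝ := fun q j ↦ h j (dropComponent (i j) q)
  have hFd : ∀ q ∈ U', ContDiffAt ℝ ∞ F (Φ q) := fun q hq ↦
    hF.contDiffAt (O.isOpen.mem_nhds (hfF q hq).1)
  have hΦ' := contMDiffOn_opens_iff.1 hΦ
  refine ⟨U', hU'U, hpU', r, fun j ↦ differential _ (h j ∘ dropComponent (i j)), fun j ↦
    ⟨⟨dropComponent (i j) ⁻¹' (V j), (V j).isOpen.preimage (continuous_dropComponent _)⟩,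
      fun q hq ↦ hV q hq j, ⟨i j, _, comp_dropComponent_mem_pullback (hh j) (i j), rfl⟩,
      smoothOn_differential (comp_dropComponent_mem_pullback (hh j) (i j)).1⟩,
    fun j q ↦ fderiv ℝ F (Φ q) (Pi.single j 1), fun j ↦ ?_, fun q hq ↦ ?_⟩
  · refine contMDiffOn_opens_iff.2 fun q hq ↦ ?_
    have h1 : ContMDiffAt (powModel E (n + 1)) 𝓘(ℝ, (Fin r → ℝ) →L[ℝ] ℝ) ∞
        (fun q ↦ fderiv ℝ F (Φ q)) q :=
      ((hFd q hq).fderiv_right (m := ∞) (by simp)).contMDiffAt.comp q (hΦ' q hq)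
    exact h1.clm_apply contMDiffAt_const
  · have hd := (hΦ' q hq).mdifferentiableAt (by simp)
    have h1 : tderiv (powModel E (n + 1)) f q =
        (fderiv ℝ F (Φ q)).comp (tderiv (powModel E (n + 1)) Φ q) :=
      (tderiv_congr (Filter.eventuallyEq_of_mem (U'.isOpen.mem_nhds hq)
        fun y hy ↦ (hfF y hy).2)).trans
        (tderiv_comp (f := Φ) ((hFd q hq).differentiableAt (by simp)) hd)
    have h2 : ∀ j, tderiv (powModel E (n + 1)) (h j ∘ dropComponent (i j)) q =
        (ContinuousLinearMap.proj (R := ℝ) (φ := fun _ ↦ ℝ) j).comp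
          (tderiv (powModel E (n + 1)) Φ q) := by
      intro j
      have h3 := tderiv_comp (I := powModel E (n + 1)) (f := Φ) (x := q)
        (g := ContinuousLinearMap.proj (R := ℝ) (φ := fun _ ↦ ℝ) j)
        (ContinuousLinearMap.differentiableAt _) hd
      rwa [ContinuousLinearMap.fderiv] at h3
    have h4 : tderiv (powModel E (n + 1)) f q = ∑ j, fderiv ℝ F (Φ q) (Pi.single j 1) •
        tderiv (powModel E (n + 1)) (h j ∘ dropComponent (i j)) q := by
      simp only [h1, h2]
      ext1 v
      generalize tderiv (powModel E (n + 1)) Φ q = T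
      simp only [ContinuousLinearMap.comp_apply, sum_apply, smul_apply,
        ContinuousLinearMap.proj_apply, smul_eq_mul]
      conv_lhs => rw [← Finset.univ_sum_single (T v), map_sum]
      refine Finset.sum_congr rfl fun j _ ↦ ?_
      rw [mul_comm, ← smul_eq_mul, ← map_smul, ← Pi.single_smul', smul_eq_mul, mul_one]
    exact h4

end Generic

end JointInvariants

end

theorem mainTheorem2
    {EG : Type*} [NormedAddCommGroup EG] [NormedSpace ℝ EG] [FiniteDimensional ℝ EG]
    {G : Type*} [TopologicalSpace G] [ChartedSpace EG G] [Group G] [LieGroup 𝓘(ℝ, EG) ∞ G]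
    [ConnectedSpace G]
    {E : Type*} [NormedAddCommGroup E] [NormedSpace ℝ E] [FiniteDimensional ℝ E]
    {M : Type*} [TopologicalSpace M] [ChartedSpace E M] [IsManifold 𝓘(ℝ, E) ∞ M]
    [MulAction G M] [ContMDiffSMul 𝓘(ℝ, EG) 𝓘(ℝ, E) ∞ G M]
    -- the numbers of points are `n = k - 1` and `n + 1 = k`
    (n : ℕ)
    (W₀ : Opens (Fin n → M)) (hW₀ : Dense (W₀ : Set (Fin n → M)))
    (hregular : (JointInvariants.jointPfaff E M n EG G).IsRegularOn W₀)
    (hintegrable : (JointInvariants.jointPfaff E M n EG G).IsIntegrableOn W₀)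
    (W₁ : Opens (Fin (n + 1) → M)) (hW₁ : Dense (W₁ : Set (Fin (n + 1) → M)))
    (hcond : ∀ p ∈ W₁,
      ⨅ i : Fin (n + 1), (JointInvariants.jointDistribution E EG G p ⊔
        LinearMap.ker (mfderiv (JointInvariants.powModel E (n + 1)) (JointInvariants.powModel E n)
          (JointInvariants.dropComponent i) p).toLinearMap) =
      JointInvariants.jointDistribution E EG G p) :
    ∃ W : Opens (Fin (n + 1) → M),
      (∀ p, p ∈ W ↔ p ∈ W₁ ∧ ∀ i : Fin (n + 1), JointInvariants.dropComponent i p ∈ W₀ ∧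
        (JointInvariants.jointPfaff E M n EG G).perp (JointInvariants.dropComponent i p) =
          JointInvariants.jointDistribution E EG G (JointInvariants.dropComponent i p)) ∧
      Dense (W : Set (Fin (n + 1) → M)) ∧
      (∀ U ≤ W, (JointInvariants.jointInvariants E M (n + 1) EG G).sections U =
        (JointInvariants.liftedInvariants E M n EG G).sections U) ∧
      (∀ (U : Opens (Fin (n + 1) → M)) (f : (Fin (n + 1) → M) → ℝ),
        ContMDiffOn (JointInvariants.powModel E (n + 1)) 𝓘(ℝ, ℝ) ∞ f U →
        (f ∈ (JointInvariants.jointInvariants E M (n + 1) EG G).sections U ↔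
          f ∈ (JointInvariants.liftedInvariants E M n EG G).sections (U ⊓ W))) ∧
      ∀ (U : Opens (Fin (n + 1) → M)),
        ∀ f ∈ (JointInvariants.jointInvariants E M (n + 1) EG G).sections U, ∀ p ∈ U ⊓ W,
        ∃ (r : ℕ) (i : Fin r → Fin (n + 1)) (V : Fin r → Opens (Fin n → M))
          (h : Fin r → (Fin n → M) → ℝ) (O : Opens (Fin r → ℝ)) (F : (Fin r → ℝ) → ℝ),
          (∀ j, JointInvariants.dropComponent (i j) p ∈ V j ∧
            h j ∈ (JointInvariants.jointInvariants E M n EG G).sections (V j)) ∧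
          (fun j ↦ h j (JointInvariants.dropComponent (i j) p)) ∈ O ∧ ContDiffOn ℝ ∞ F O ∧
          ∀ᶠ q in 𝓝 p, f q = F (fun j ↦ h j (JointInvariants.dropComponent (i j) q)) := by
  set D : Set (Fin n → M) := {q | q ∈ W₀ ∧ (JointInvariants.jointPfaff E M n EG G).perp q =
    JointInvariants.jointDistribution E EG G q} with hD
  have hDo : IsOpen D := JointInvariants.isOpen_perp_eq hregular
  -- The set where the orthogonal distribution is the orbit distribution is dense but need not be
  -- open; openness of `W₀` suffices for the intersection to stay dense.
  have hDd : Dense D := hW₀.inter_of_isOpen_left (JointInvariants.dense_perp_eq EG G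
    (JointInvariants.powModel E n) (Fin n → M)) W₀.isOpen
  have hpre : ∀ i : Fin (n + 1), IsOpen (JointInvariants.dropComponent i ⁻¹' D) := fun i ↦
    hDo.preimage (JointInvariants.continuous_dropComponent i)
  set W : Opens (Fin (n + 1) → M) := W₁ ⊓ ⟨⋂ i, JointInvariants.dropComponent i ⁻¹' D,
    isOpen_iInter_of_finite hpre⟩ with hW
  have hmem : ∀ p, p ∈ W ↔ p ∈ W₁ ∧ ∀ i : Fin (n + 1), JointInvariants.dropComponent i p ∈ W₀ ∧
      (JointInvariants.jointPfaff E M n EG G).perp (JointInvariants.dropComponent i p) =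
        JointInvariants.jointDistribution E EG G (JointInvariants.dropComponent i p) :=
    fun p ↦ and_congr_right fun _ ↦ mem_iInter
  have hWd : Dense (W : Set (Fin (n + 1) → M)) :=
    hW₁.inter_of_isOpen_left (JointInvariants.dense_iInter_of_isOpen_of_fintype hpre fun i ↦
      hDd.preimage (JointInvariants.isOpenMap_dropComponent i)) W₁.isOpen
  have hle : ∀ U ≤ W, ∀ f ∈ (JointInvariants.jointInvariants E M (n + 1) EG G).sections U,
      f ∈ (JointInvariants.liftedInvariants E M n EG G).sections U := fun U hU f hf ↦
    JointInvariants.mem_liftedInvariants_of_mem_jointInvariants hintegrable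
      (fun p hp ↦ hcond p ((hmem p).1 (hU hp)).1) (fun p hp ↦ ((hmem p).1 (hU hp)).2) hf
  refine ⟨W, hmem, hWd, fun U hU ↦ Set.Subset.antisymm (hle U hU) fun f hf ↦
    JointInvariants.mem_jointInvariants_of_mem_liftedInvariants hf, fun U f hf ↦
    ⟨fun h ↦ hle _ inf_le_right f ((JointInvariants.jointInvariants E M (n + 1) EG G).restrict inf_le_left h), fun h ↦
      JointInvariants.mem_jointInvariants_of_dense hWd hf
        (JointInvariants.mem_jointInvariants_of_mem_liftedInvariants h)⟩, fun U f hf p hp ↦ ?_⟩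
  obtain ⟨r, i, V, h, O, F, U', hh, hpU', -, hV, -, hF, hfF⟩ :=
    JointInvariants.exists_eq_comp_lifted hintegrable (hcond p ((hmem p).1 hp.2).1)
      ((hmem p).1 hp.2).2 hf hp.1
  refine ⟨r, i, V, h, O, F, fun j ↦ ⟨hV p hpU' j, hh j⟩, (hfF p hpU').1, hF, ?_⟩
  filter_upwards [U'.isOpen.mem_nhds hpU'] with q hq
  exact (hfF q hq).2
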